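/- Let $\mathbb{T}=\mathbb{R}/2\pi\mathbb{Z}$ with Lebesgue measure $dx$ of total mass $2\pi$, and let $(X_t)_{t\ge 0}$ be a stochastic process with values in $\mathbb{T}$ for which there are distributions $D_t$ ($t\ge0$) on $\mathbb{T}$ such that 1. $X_{t_2}-X_{t_1}\sim D_{t_2-t_1}$ for all $0\le t_1\le t_2$; 2. for all $0\le t_1\le\dots\le t_n$ the increments $X_{t_2}-X_{t_1},\dots,X_{t_n}-X_{t_{n-1}}$ are independent; 3. $D_{t+s}=D_t\star D_s$ for all $s,t\ge 0$; 4. for every $t>0$, $D_t=\beta_t\,\delta_0+(1-\beta_t)\,\gamma_t\,dx$, where $\beta_t\in[0,1]$ and $\gamma_t\in L^2(\mathbb{T})$ is a probability density, and $\beta_t$ is not identically $1$ on $(0,\infty)$. Let $\mathcal{F}_1$ be the family of indicator functions $\mathbf{1}_U:\mathbb{T}\to\mathbb{R}$ of open sets $U\subseteq\mathbb{T}$ whose boundary has Lebesgue measure $0$. **Theorem 1.3 (Symmetric reconstruction).** Suppose that $\gamma_t$ is symmetric for every $t>0$, i.e. $\gamma_t(y)=\gamma_t(-y)$ for almost every $y\in\mathbb{T}$,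 and that there is a time $t_0>0$ such that the Fourier coefficients $$\hat\gamma_{t_0}(k)=\int_{\mathbb{T}}\gamma_{t_0}(x)e^{-ikx}\,dx,\qquad k=0,1,2,\dots,$$ are all distinct and nonzero. Then $\mathcal{F}_1$ is reconstructible by $X_t$ up to rotations and reflections. That is, there is a function $A:\mathbb{R}^{[0,\infty)}\to\mathbb{R}^{\mathbb{T}}$ such that for every $f\in\mathcal{F}_1$, with probability $1$ there is a (random) $\theta\in\mathbb{T}$ such that either $A\big((f(X_t))_{t\ge0}\big)(x)=f(x+\theta)$ for almost all $x\in\mathbb{T}$, or $A\big((f(X_t))_{t\ge0}\big)(x)=f(-x+\theta)$ for almost all $x\in\mathbb{T}$. -/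

import Mathlib

open MeasureTheory ProbabilityTheory
open scoped NNReal ENNReal Real

namespace Scenery

instance fact_zero_lt_two_pi : Fact (0 < 2 * π) := ⟨Real.two_pi_pos⟩

/-- The circle `𝕋 = ℝ / 2πℤ`. Its `volume` is Lebesgue measure, of total mass `2π`. -/
abbrev Circ : Type := AddCircle (2 * π)

/-- The unnormalised Fourier coefficient `ĝ(k) = ∫_𝕋 g(x) e^{-ikx} dx`
(`fourier (-k) x = e^{-ikx}` on `ℝ / 2πℤ`; see `fourier_neg_coe`). -/
noncomputable def fourierHat (g : Circ → ℝ) (k : ℤ) : ℂ :=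
  ∫ x : Circ, (g x : ℂ) * fourier (-k) x

theorem fourier_neg_coe (k : ℤ) (x : ℝ) :
    fourier (-k) (x : Circ) = Complex.exp (-(Complex.I * k * x)) := by
  rw [fourier_coe_apply]
  have h : (π : ℂ) ≠ 0 := by exact_mod_cast Real.pi_ne_zero
  congr 1
  push_cast
  field_simp

/-- `X` is a stochastic process on the circle with independent increments, in which the increment
over a time interval of length `t` has law `D t`, where `D` is a convolution semigroup.
Nothing is assumed about the starting point `X 0` or about regularity of the paths. -/
structure IsIncrementProcess {Ω : Type*} [MeasurableSpace Ω] (P : Measure Ω)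
    (X : ℝ≥0 → Ω → Circ) (D : ℝ≥0 → Measure Circ) : Prop where
  measurable : ∀ t, Measurable (X t)
  hasLaw_sub : ∀ s t, s ≤ t → HasLaw (fun ω => X t ω - X s ω) (D (t - s)) P
  hasIndepIncrements : HasIndepIncrements X P
  conv_eq : ∀ s t, D (s + t) = Measure.conv (D s) (D t)

/-- `g` is a square-integrable probability density function on the circle. -/
structure IsL2Density (g : Circ → ℝ) : Prop where
  nonneg : ∀ᵐ x : Circ, 0 ≤ g x
  integral_eq_one : ∫ x : Circ, g x = 1
  memLp : MemLp g 2 volume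

/-- For every positive time `t`, the law `D t` is the mixture `β_t δ_0 + (1 - β_t) γ_t` of an atom
at `0` and a distribution with an `L²` density `γ_t`; moreover `β` is not identically `1` on
positive times, i.e. the process does move. (At time `0` the law is the atom.) -/
structure IsAtomDensityMixture (D : ℝ≥0 → Measure Circ) (β : ℝ≥0 → ℝ)
    (γ : ℝ≥0 → Circ → ℝ) : Prop where
  mem_Icc : ∀ t, 0 < t → β t ∈ Set.Icc (0 : ℝ) 1
  density : ∀ t, 0 < t → IsL2Density (γ t)
  eq_mixture : ∀ t, 0 < t →
    D t = ENNReal.ofReal (β t) • Measure.dirac 0 +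
      ENNReal.ofReal (1 - β t) • (volume : Measure Circ).withDensity
        (fun x => ENNReal.ofReal (γ t x))
  exists_ne_one : ∃ t, 0 < t ∧ β t ≠ 1

/-- The family `F₁` of indicator functions of the open subsets of the circle whose boundary has
Lebesgue measure zero. -/
def openIndicators : Set (Circ → ℝ) :=
  {f | ∃ U : Set Circ, IsOpen U ∧ volume (frontier U) = 0 ∧ f = U.indicator (fun _ => 1)}

/-- The family `F` is reconstructible up to rotations and reflections by the process `X`:
a single map `A`, applied to the trace `t ↦ f (X t)`, returns almost surely, for each `f ∈ F`,
a function that agrees almost everywhere with `x ↦ f (x + θ)` or with `x ↦ f (-x + θ)`, for some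
(random) `θ`. -/
def IsReconstructibleUpToReflections {Ω : Type*} [MeasurableSpace Ω] (P : Measure Ω)
    (X : ℝ≥0 → Ω → Circ) (F : Set (Circ → ℝ)) : Prop :=
  ∃ A : (ℝ≥0 → ℝ) → (Circ → ℝ), ∀ f ∈ F, ∀ᵐ ω ∂P, ∃ θ : Circ,
    (∀ᵐ x : Circ, A (fun t => f (X t ω)) x = f (x + θ)) ∨
    (∀ᵐ x : Circ, A (fun t => f (X t ω)) x = f (-x + θ))

end Scenery

/-! Sample the process at the multiples of `t₀`. The increments are independent, so the samples form
a random walk whose transition operator `T` is diagonal in the Fourier basis, with eigenvalues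
`charLaw D t₀ k`. Almost surely the time averages of products of readings of `f` along a word
converge to the vacuum expectation `⟨e₀, M T M T ⋯ e₀⟩` of the corresponding word in `T` and the
multiplication operator `M` by `f` (`IsErgodicSeq.hasCesaro_wordEval`). The trace therefore
determines all these numbers, and it remains to see that they determine `f` up to isometry.

Symmetry makes the eigenvalues real and even, and their distinctness for `k ≥ 0` makes them separate
frequencies up to sign. Here `β_{t₀} ≠ 1` is needed; it follows from the semigroup law and
Riemann–Lebesgue (`atom_ne_one`). Polynomials in `T` then converge strongly to the projections onto
the pairs `{j, -j}`, so inserting these projections between copies of `M` yields further known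
quantities: the sums `pathCoeff` of products of Fourier coefficients `a` of `f` over paths whose
frequencies are known up to sign.

To isolate a single product, start the path by a jump to a huge `J`, make the steps of a zero-sum
list there, and jump back. A change of sign along the way costs a factor `a (2J + c) → 0`, so only
the two conjugate constant-sign paths survive, and the sum is `2 |a J|² Re ∏ a(xᵢ)` to leading order
(`pathCoeff_pathFrom_zero_isLittleO`). Dividing by `|a J|²` requires infinitely many nonzero
coefficients; otherwise the indicator is almost everywhere constant.

The real parts of all zero-sum products fix the products up to one global conjugation, which is the
reflection, and the products fix `a` up to a character, which is the rotation
(`exists_isometry_of_re_prod_eq`). The reconstruction map picks any open set whose word expectations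
match the averages of the trace. -/

namespace Scenery

open Filter Asymptotics
open scoped Topology ComplexConjugate

/-! ### Recovering coefficients from zero-sum products. -/

section ZeroSumProducts

variable {a b : ℤ → ℂ}

theorem prod_map_neg_eq_conj (ha : ∀ k, a (-k) = conj (a k)) (L : List ℤ) :
    ((L.map Neg.neg).map a).prod = conj (L.map a).prod := by
  induction L with
  | nil => simp
  | cons x L ih => simp only [List.map_cons, List.prod_cons, map_mul, ih, ha]

theorem sum_map_neg (L : List ℤ) : (L.map Neg.neg).sum = -L.sum := by
  induction L with
  | nil => simp
  | cons x L ih => simp only [List.map_cons, List.sum_cons, ih]; ring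

/-- Coefficients whose products along zero-sum lists of frequencies agree differ by a
rotation. -/
theorem exists_rotation_of_prod_eq (ha : ∀ k, a (-k) = conj (a k)) (hb : ∀ k, b (-k) = conj (b k))
    (h : ∀ L : List ℤ, L.sum = 0 → (L.map b).prod = (L.map a).prod) :
    ∃ θ : ℝ, ∀ k : ℤ, b k = Complex.exp (Complex.I * k * θ) * a k := by
  have hnorm : ∀ k, ‖b k‖ = ‖a k‖ := by
    intro k
    have := h [k, -k] (by simp)
    simp only [List.map_cons, List.map_nil, List.prod_cons, List.prod_nil, mul_one, ha, hb,
      Complex.mul_conj, Complex.normSq_eq_norm_sq] at this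
    have h2 : ‖b k‖ ^ 2 = ‖a k‖ ^ 2 := by exact_mod_cast this
    exact (sq_eq_sq₀ (norm_nonneg _) (norm_nonneg _)).1 h2
  set s : Set ℤ := {k | a k ≠ 0} with hs
  -- The support generates some `dℤ`, and it is stable under negation, so `d` itself is a sum of
  -- supported frequencies. The ratio of the two products along that sum is the phase `ζ` that the
  -- rotation must give to frequency `d`.
  obtain ⟨d, hd⟩ := Int.subgroup_cyclic (AddSubgroup.closure s)
  have hdmem : d ∈ AddSubgroup.closure s := by
    rw [hd]; exact AddSubgroup.subset_closure rfl
  obtain ⟨L, hL, hLsum⟩ : ∃ L : List ℤ, (∀ x ∈ L, x ∈ s) ∧ L.sum = d := by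
    refine AddSubgroup.closure_induction (p := fun x _ => ∃ L : List ℤ, (∀ x ∈ L, x ∈ s) ∧ L.sum = x)
      ?_ ?_ ?_ ?_ hdmem
    · intro x hx
      exact ⟨[x], by simpa using hx, by simp⟩
    · exact ⟨[], by simp, by simp⟩
    · rintro x y - - ⟨L, hL, rfl⟩ ⟨K, hK, rfl⟩
      exact ⟨L ++ K, by
        intro x hx
        rcases List.mem_append.1 hx with h | h
        exacts [hL x h, hK x h], by simp⟩
    · rintro x - ⟨L, hL, rfl⟩
      refine ⟨L.map Neg.neg, ?_, sum_map_neg L⟩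
      intro x hx
      obtain ⟨y, hy, rfl⟩ := List.mem_map.1 hx
      have := hL y hy
      simp only [hs, Set.mem_ofPred_eq] at this ⊢
      rw [ha]
      simpa using this
  set A := (L.map a).prod with hA
  set B := (L.map b).prod with hB
  have hA0 : A ≠ 0 := by
    rw [hA]
    apply List.prod_ne_zero
    intro h0
    obtain ⟨x, hx, hx0⟩ := List.mem_map.1 h0
    exact hL x hx hx0
  have hAB : ‖B‖ = ‖A‖ := by
    rw [hA, hB]
    clear_value A B
    clear hLsum hL hA hB hA0
    induction L with
    | nil => simp
    | cons x L ih => simp [hnorm, ih]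
  set ζ := B / A with hζ
  have hζn : ‖ζ‖ = 1 := by
    rw [hζ, norm_div, hAB, div_self (norm_ne_zero_iff.2 hA0)]
  have hBζ : B = ζ * A := by rw [hζ, div_mul_cancel₀ _ hA0]
  have hζarg : ζ = Complex.exp (Complex.I * (ζ.arg : ℝ)) := by
    conv_lhs => rw [← Complex.norm_mul_exp_arg_mul_I ζ, hζn]
    simp [mul_comm]
  have hpos : ∀ (n : ℕ) (k : ℤ), k = n * d → b k = ζ ^ n * a k := by
    intro n k hk
    -- The zero-sum list that compares `k = n * d` with `n` copies of `-L`; negated frequencies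
    -- contribute conjugates, and `|ζ| = 1` turns the conjugate into an inverse.
    have h1 := h (k :: (List.replicate n (L.map Neg.neg)).flatten) (by
      simp only [List.sum_cons, List.sum_flatten, List.map_replicate, List.sum_replicate,
        sum_map_neg, hLsum, hk]
      simp)
    simp only [List.map_cons, List.prod_cons, List.map_flatten, List.map_replicate,
      List.prod_flatten, List.prod_replicate, prod_map_neg_eq_conj ha, prod_map_neg_eq_conj hb,
      ← hA, ← hB] at h1
    rw [hBζ, map_mul, mul_pow] at h1
    have hcA : (conj A) ^ n ≠ 0 := pow_ne_zero _ (by simpa using hA0)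
    have h2 : b k * (conj ζ) ^ n = a k := by
      apply mul_right_cancel₀ hcA
      rw [← h1]; ring
    have h3 : ζ * conj ζ = 1 := by
      rw [Complex.mul_conj, Complex.normSq_eq_norm_sq, hζn]; simp
    calc b k = b k * (ζ * conj ζ) ^ n := by rw [h3]; simp
      _ = ζ ^ n * (b k * (conj ζ) ^ n) := by rw [mul_pow]; ring
      _ = ζ ^ n * a k := by rw [h2]
  have hposexp : ∀ (n : ℕ) (k : ℤ), k = n * d →
      b k = Complex.exp (Complex.I * k * ((ζ.arg / d : ℝ))) * a k := by
    intro n k hk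
    -- For `d = 0` the angle `ζ.arg / d` is the default value `0`, which is harmless since only `k =
    -- 0` occurs.
    rcases eq_or_ne d 0 with rfl | hd0
    · have hk0 : k = 0 := by simpa using hk
      subst hk0
      have := hpos 0 0 (by simp)
      simpa using this
    · rw [hpos n k hk]
      congr 1
      conv_lhs => rw [hζarg]
      rw [← Complex.exp_nat_mul, hk]
      congr 1
      have : (d : ℂ) ≠ 0 := by exact_mod_cast hd0
      push_cast
      field_simp
  refine ⟨ζ.arg / d, fun k => ?_⟩
  by_cases hk : a k = 0
  · have : b k = 0 := by
      rw [← norm_eq_zero, hnorm, hk, norm_zero]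
    rw [this, hk, mul_zero]
  have hkd : k ∈ AddSubgroup.closure ({d} : Set ℤ) := hd ▸ AddSubgroup.subset_closure hk
  obtain ⟨n, hn⟩ := AddSubgroup.mem_closure_singleton.1 hkd
  rw [smul_eq_mul] at hn
  obtain ⟨m, rfl | rfl⟩ := n.eq_nat_or_neg
  · exact hposexp m k hn.symm
  · have h1 := hposexp m (-k) (by rw [← hn]; ring)
    rw [ha, hb] at h1
    have h2 := congrArg conj h1
    rw [map_mul, Complex.conj_conj, Complex.conj_conj, ← Complex.exp_conj] at h2
    rw [h2]
    congr 2
    simp only [map_mul, Complex.conj_I, Complex.conj_ofReal, map_intCast]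
    push_cast
    ring

/-- Conjugate-symmetric coefficients for which the products along zero-sum lists of frequencies
have the same real parts differ by a rotation or a reflection. -/
theorem exists_isometry_of_re_prod_eq (ha : ∀ k, a (-k) = conj (a k))
    (hb : ∀ k, b (-k) = conj (b k))
    (h : ∀ L : List ℤ, L.sum = 0 → (L.map b).prod.re = (L.map a).prod.re) :
    ∃ θ : ℝ, (∀ k : ℤ, b k = Complex.exp (Complex.I * k * θ) * a k) ∨
      ∀ k : ℤ, b k = Complex.exp (Complex.I * k * θ) * a (-k) := by
  have hnorm : ∀ k, ‖b k‖ = ‖a k‖ := by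
    intro k
    have := h [k, -k] (by simp)
    simp only [List.map_cons, List.map_nil, List.prod_cons, List.prod_nil, mul_one, ha, hb,
      Complex.mul_conj, Complex.normSq_eq_norm_sq, Complex.ofReal_re] at this
    exact (sq_eq_sq₀ (norm_nonneg _) (norm_nonneg _)).1 this
  have hnormP : ∀ L : List ℤ, ‖(L.map b).prod‖ = ‖(L.map a).prod‖ := by
    intro L
    induction L with
    | nil => simp
    | cons x L ih => simp [hnorm, ih]
  have him : ∀ L : List ℤ, L.sum = 0 → (L.map b).prod.im = (L.map a).prod.im ∨
      (L.map b).prod.im = -(L.map a).prod.im := by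
    intro L hL
    have h1 := congrArg (· ^ 2) (hnormP L)
    simp only [← Complex.normSq_eq_norm_sq, Complex.normSq_apply, h L hL] at h1
    exact sq_eq_sq_iff_eq_or_eq_neg.1 (by linarith)
  by_cases hall : ∀ L : List ℤ, L.sum = 0 → (L.map b).prod = (L.map a).prod
  · obtain ⟨θ, hθ⟩ := exists_rotation_of_prod_eq ha hb hall
    exact ⟨θ, Or.inl hθ⟩
  -- One list `L₀` has a non-real product that is conjugated. Appending it to any other `L` and
  -- comparing real parts forces the product along `L` to be conjugated too, so conjugation is a
  -- global choice.
  · push Not at hall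
    obtain ⟨L₀, hL₀, hne⟩ := hall
    have h0 : (L₀.map b).prod.im = -(L₀.map a).prod.im := by
      rcases him L₀ hL₀ with h1 | h1
      · exact absurd (Complex.ext (h L₀ hL₀) h1) hne
      · exact h1
    have h0ne : (L₀.map a).prod.im ≠ 0 := by
      intro h1
      exact hne (Complex.ext (h L₀ hL₀) (by rw [h0, h1, neg_zero]))
    have hconj : ∀ L : List ℤ, L.sum = 0 →
        (L.map b).prod = (L.map (fun k => a (-k))).prod := by
      intro L hL
      have e : (L.map (fun k => a (-k))).prod = conj (L.map a).prod := by
        rw [← prod_map_neg_eq_conj ha, List.map_map]; rfl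
      rw [e]
      have key : (L.map b).prod.im = -(L.map a).prod.im := by
        rcases him L hL with h1 | h1
        · have h2 := h (L ++ L₀) (by simp [hL, hL₀])
          simp only [List.map_append, List.prod_append, Complex.mul_re, h L hL, h L₀ hL₀, h1,
            h0] at h2
          have h3 : (L.map a).prod.im * (L₀.map a).prod.im = 0 := by linarith
          have h4 : (L.map a).prod.im = 0 := (mul_eq_zero.1 h3).resolve_right h0ne
          rw [h1, h4, neg_zero]
        · exact h1
      exact Complex.ext (by simpa using h L hL) (by simpa using key)
    obtain ⟨θ, hθ⟩ := exists_rotation_of_prod_eq (a := fun k => a (-k)) (b := b)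
      (fun k => ha (-k)) hb hconj
    exact ⟨θ, Or.inr hθ⟩

end ZeroSumProducts

/-! ### Asymptotics of signed path sums through a far frequency. -/

section PathCoefficients

/-- The sum, over all choices of signs of the entries of a list of frequencies, of the products
of the coefficients `a` at the increments of the path `0, ..., k` through these frequencies; the
most recently visited frequency is the head of the list. -/
def pathCoeff (a : ℤ → ℂ) : List ℤ → ℤ → ℂ
  | [], k => a k
  | j :: l, k => a (k - j) * pathCoeff a l j + a (k + j) * pathCoeff a l (-j)

/-- The frequencies visited when starting at `J` and adding the entries of a list, from its last
to its first. -/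
def pathFrom (J : ℤ) : List ℤ → List ℤ
  | [] => [J]
  | x :: l => (J + (x + l.sum)) :: pathFrom J l

variable {a b : ℤ → ℂ}

theorem pathCoeff_neg (ha : ∀ k, a (-k) = conj (a k)) (l : List ℤ) (k : ℤ) :
    pathCoeff a l (-k) = conj (pathCoeff a l k) := by
  induction l generalizing k with
  | nil => exact ha k
  | cons j l ih =>
    simp only [pathCoeff, map_add, map_mul, ih, Complex.conj_conj, ← ha]
    rw [show -(k - j) = -k + j by ring, show -(k + j) = -k - j by ring]
    ring

theorem tendsto_comp_add_two_mul (hlim : Tendsto a cofinite (𝓝 0)) (c : ℤ) :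
    Tendsto (fun J : ℕ => a (2 * J + c)) atTop (𝓝 0) := by
  rw [← Nat.cofinite_eq_atTop]
  refine hlim.comp (Function.Injective.tendsto_cofinite ?_)
  intro m n h
  simp only at h
  omega

/-- Near `J`, the path that never changes sign sees the increments in `x :: l` and picks up `a J`
from its first jump. Passing between the neighbourhoods of `J` and `-J` is an increment of the form
`2J + c`, whose coefficient tends to zero, and every path still carries the size of `a J` from the
first jump. -/
theorem pathCoeff_pathFrom_isLittleO (ha : ∀ k, a (-k) = conj (a k))
    (hlim : Tendsto a cofinite (𝓝 0)) (l : List ℤ) (x : ℤ) :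
    (fun J : ℕ => pathCoeff a (pathFrom J l) (J + (x + l.sum)) - a x * (l.map a).prod * a J)
      =o[atTop] fun J : ℕ => a J := by
  have hsmall : ∀ (c : ℤ) (u : ℕ → ℂ), u =O[atTop] (fun J : ℕ => a J) →
      (fun J : ℕ => a (2 * J + c) * u J) =o[atTop] fun J : ℕ => a J := by
    intro c u hu
    have := ((isLittleO_one_iff ℂ).2 (tendsto_comp_add_two_mul hlim c)).mul_isBigO hu
    simpa using this
  induction l generalizing x with
  | nil =>
    have := hsmall x (fun J => a (-J)) (by
      simp only [ha]
      exact isBigO_of_le atTop (fun J => by simp))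
    refine this.congr_left (fun J => ?_)
    simp only [pathFrom, pathCoeff, List.sum_nil, List.map_nil, List.prod_nil]
    rw [show (J : ℤ) + (x + 0) - J = x by ring, show (J : ℤ) + (x + 0) + J = 2 * J + x by ring]
    ring
  | cons y l ih =>
    have h1 := ih y
    have h2 : (fun J : ℕ => pathCoeff a (pathFrom J l) (J + (y + l.sum)))
        =O[atTop] fun J : ℕ => a J := by
      have h3 := h1.isBigO.add
        ((isBigO_refl (fun J : ℕ => a J) atTop).const_mul_left (a y * (l.map a).prod))
      refine h3.congr_left (fun J => ?_)
      ring
    -- The second summand comes from the branch near `-J`, which by conjugate symmetry is as large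
    -- as the branch near `J`, but has to cross over.
    have h4 := (h1.const_mul_left (a x)).add
      (hsmall (x + 2 * (y + l.sum)) (fun J => pathCoeff a (pathFrom J l) (-(J + (y + l.sum)))) (by
        simp only [pathCoeff_neg ha]
        exact (isBigO_of_le atTop (fun J => by simp)).trans h2))
    refine h4.congr_left (fun J => ?_)
    simp only [pathFrom, pathCoeff, List.sum_cons, List.map_cons, List.prod_cons]
    rw [show (J : ℤ) + (x + (y + l.sum)) - (J + (y + l.sum)) = x by ring,
      show (J : ℤ) + (x + (y + l.sum)) + (J + (y + l.sum)) = 2 * J + (x + 2 * (y + l.sum)) by ring]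
    ring

theorem pathCoeff_singleton_zero (ha : ∀ k, a (-k) = conj (a k)) (J : ℤ) :
    pathCoeff a [J] 0 = (2 * ‖a J‖ ^ 2 : ℝ) := by
  simp only [pathCoeff, zero_sub, zero_add, ha]
  rw [Complex.mul_conj, mul_comm, Complex.mul_conj, Complex.normSq_eq_norm_sq]
  push_cast
  ring

/-- The list has sum zero, so the path is back at `±J` before its last jump to `0`. That jump
supplies the second factor of modulus `|a J|`, and the branches through `J` and `-J` are conjugate,
which leaves twice a real part. -/
theorem pathCoeff_pathFrom_zero_isLittleO (ha : ∀ k, a (-k) = conj (a k))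
    (hlim : Tendsto a cofinite (𝓝 0)) (l : List ℤ) (hl : l.sum = 0) :
    (fun J : ℕ => pathCoeff a (pathFrom J l) 0 - ((2 * (l.map a).prod.re * ‖a J‖ ^ 2 : ℝ) : ℂ))
      =o[atTop] fun J : ℕ => ‖a J‖ ^ 2 := by
  cases l with
  | nil =>
    refine (isLittleO_zero _ _).congr_left (fun J => ?_)
    rw [pathFrom, pathCoeff_singleton_zero ha]
    simp
  | cons x l =>
    have h1 := pathCoeff_pathFrom_isLittleO ha hlim l x
    have hx : x + l.sum = 0 := by simpa using hl
    have h2 : (fun J : ℕ => conj (a J) *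
        (pathCoeff a (pathFrom J l) (J + (x + l.sum)) - a x * (l.map a).prod * a J))
        =o[atTop] fun J : ℕ => ‖a J‖ ^ 2 := by
      have h3 := (IsBigO.of_norm_le (f := fun J : ℕ => conj (a J)) (g := fun J : ℕ => ‖a J‖)
        (l := atTop) (fun J => by simp)).mul_isLittleO h1.norm_right
      simpa only [sq] using h3
    have h3 : (fun J : ℕ => conj (conj (a J) *
        (pathCoeff a (pathFrom J l) (J + (x + l.sum)) - a x * (l.map a).prod * a J)))
        =o[atTop] fun J : ℕ => ‖a J‖ ^ 2 :=
      (isBigO_of_le atTop (fun J => by rw [RCLike.norm_conj])).trans_isLittleO h2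
    refine (h2.add h3).congr_left (fun J => ?_)
    simp only [pathFrom, pathCoeff, List.map_cons, List.prod_cons, hx, add_zero, zero_sub,
      zero_add, ha, pathCoeff_neg ha]
    set p := a x * (l.map a).prod
    set q := pathCoeff a (pathFrom J l) J
    have h4 : ((2 * p.re * ‖a J‖ ^ 2 : ℝ) : ℂ) = (p + conj p) * (a J * conj (a J)) := by
      rw [Complex.add_conj, Complex.mul_conj, Complex.normSq_eq_norm_sq]
      push_cast
      ring
    rw [h4]
    simp only [map_mul, map_sub, Complex.conj_conj]
    ring

theorem pos_of_mem_pathFrom (l : List ℤ) :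
    ∀ᶠ J : ℕ in atTop, ∀ j ∈ pathFrom J l, 0 < j := by
  induction l with
  | nil =>
    filter_upwards [eventually_gt_atTop 0] with J hJ
    simpa [pathFrom] using hJ
  | cons x l ih =>
    filter_upwards [ih, eventually_gt_atTop (-(x + l.sum)).toNat] with J h1 h2
    simp only [pathFrom, List.mem_cons, forall_eq_or_imp]
    exact ⟨by omega, h1⟩

/-- The path coefficients determine the real parts of the zero-sum products. -/
theorem re_prod_eq_of_pathCoeff_eq (ha : ∀ k, a (-k) = conj (a k)) (hb : ∀ k, b (-k) = conj (b k))
    (halim : Tendsto a cofinite (𝓝 0)) (hblim : Tendsto b cofinite (𝓝 0))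
    (hinf : ∃ᶠ J : ℕ in atTop, a J ≠ 0)
    (h : ∀ l : List ℤ, (∀ j ∈ l, 0 < j) → pathCoeff b l 0 = pathCoeff a l 0)
    (l : List ℤ) (hl : l.sum = 0) : (l.map b).prod.re = (l.map a).prod.re := by
  have hnorm : ∀ J : ℤ, 0 < J → ‖b J‖ ^ 2 = ‖a J‖ ^ 2 := by
    intro J hJ
    have h1 := h [J] (by simpa using hJ)
    rw [pathCoeff_singleton_zero ha, pathCoeff_singleton_zero hb, Complex.ofReal_inj] at h1
    linarith
  have hA := pathCoeff_pathFrom_zero_isLittleO ha halim l hl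
  have hB := pathCoeff_pathFrom_zero_isLittleO hb hblim l hl
  have hev : ∀ᶠ J : ℕ in atTop, ‖b J‖ ^ 2 = ‖a J‖ ^ 2 := by
    filter_upwards [eventually_gt_atTop 0] with J hJ
    exact hnorm J (by exact_mod_cast hJ)
  -- The one-point path `[J]` already gives `|b J| = |a J|`, so both error terms are measured on the
  -- same scale.
  have hB' := hB.congr' (EventuallyEq.refl _ _) hev
  have hD := hA.sub hB'
  have hD2 : (fun J : ℕ => (((2 * ((l.map b).prod.re - (l.map a).prod.re)) * ‖a J‖ ^ 2 : ℝ) : ℂ))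
      =o[atTop] fun J : ℕ => ‖a J‖ ^ 2 := by
    refine hD.congr' ?_ (EventuallyEq.refl _ _)
    filter_upwards [hev, pos_of_mem_pathFrom l] with J h1 h2
    rw [h _ h2, h1]
    push_cast
    ring
  by_contra hne
  have hc : 0 < |2 * ((l.map b).prod.re - (l.map a).prod.re)| :=
    abs_pos.2 (mul_ne_zero two_ne_zero (sub_ne_zero.2 hne))
  have h5 := hD2.bound (half_pos hc)
  obtain ⟨J, hJ0, hJ⟩ := (hinf.and_eventually h5).exists
  have hpos : 0 < ‖a J‖ ^ 2 := by positivity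
  rw [Complex.norm_real, norm_mul, Real.norm_eq_abs, Real.norm_of_nonneg hpos.le] at hJ
  nlinarith

end PathCoefficients


/-! ### Strong limits, spectral projections and words of operators. -/

section Operators

variable {H : Type*} [NormedAddCommGroup H] [InnerProductSpace ℂ H]

/-- Products of bounded strongly convergent sequences of operators converge strongly. -/
theorem tendsto_mul_apply {A A' : ℕ → H →L[ℂ] H} {L L' : H →L[ℂ] H} {C : ℝ}
    (hA : ∀ n, ‖A n‖ ≤ C) (hL : ∀ v, Tendsto (fun n => A n v) atTop (𝓝 (L v)))
    (hL' : ∀ v, Tendsto (fun n => A' n v) atTop (𝓝 (L' v))) (v : H) :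
    Tendsto (fun n => (A n * A' n) v) atTop (𝓝 ((L * L') v)) := by
  have h1 : Tendsto (fun n => A n (A' n v - L' v)) atTop (𝓝 0) := by
    have h0 : Tendsto (fun n => C * ‖A' n v - L' v‖) atTop (𝓝 0) := by
      have := ((tendsto_iff_norm_sub_tendsto_zero).1 (hL' v)).const_mul C
      simpa using this
    refine squeeze_zero_norm (fun n => ?_) h0
    exact (A n).le_of_opNorm_le (hA n) _
  have h2 := h1.add (hL (L' v))
  simpa using h2

/-- The pairs of operators that are limits, in the strong operator topology, of bounded sequences
in an algebra of pairs of operators. -/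
def strongLimits (S : Subalgebra ℂ ((H →L[ℂ] H) × (H →L[ℂ] H))) :
    Submonoid ((H →L[ℂ] H) × (H →L[ℂ] H)) where
  carrier := {p | ∃ q : ℕ → (H →L[ℂ] H) × (H →L[ℂ] H), (∀ n, q n ∈ S) ∧ (∃ C, ∀ n, ‖q n‖ ≤ C) ∧
    ∀ v, Tendsto (fun n => (q n).1 v) atTop (𝓝 (p.1 v)) ∧
      Tendsto (fun n => (q n).2 v) atTop (𝓝 (p.2 v))}
  one_mem' := ⟨fun _ => 1, fun _ => S.one_mem, ⟨_, fun _ => le_rfl⟩,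
    fun _ => ⟨tendsto_const_nhds, tendsto_const_nhds⟩⟩
  mul_mem' := by
    rintro p p' ⟨q, hq, ⟨C, hC⟩, hlim⟩ ⟨q', hq', ⟨C', hC'⟩, hlim'⟩
    -- Boundedness is part of the definition because multiplication is jointly continuous for the
    -- strong topology only on bounded sets.
    refine ⟨fun n => q n * q' n, fun n => S.mul_mem (hq n) (hq' n), ⟨C * C', fun n => ?_⟩,
      fun v => ⟨?_, ?_⟩⟩
    · exact (norm_mul_le _ _).trans
        (mul_le_mul (hC n) (hC' n) (norm_nonneg _) ((norm_nonneg _).trans (hC n)))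
    · exact tendsto_mul_apply (fun n => (norm_fst_le _).trans (hC n)) (fun v => (hlim v).1)
        (fun v => (hlim' v).1) v
    · exact tendsto_mul_apply (fun n => (norm_snd_le _).trans (hC n)) (fun v => (hlim v).2)
        (fun v => (hlim' v).2) v

theorem mem_strongLimits_of_mem {S : Subalgebra ℂ ((H →L[ℂ] H) × (H →L[ℂ] H))}
    {p : (H →L[ℂ] H) × (H →L[ℂ] H)} (hp : p ∈ S) : p ∈ strongLimits S :=
  ⟨fun _ => p, fun _ => hp, ⟨_, fun _ => le_rfl⟩,
    fun _ => ⟨tendsto_const_nhds, tendsto_const_nhds⟩⟩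

/-- If the two components of each product of elements of `s` have the same vacuum expectation, then
so have the two components of each strong limit of the algebra generated by `s`. -/
theorem inner_eq_of_mem_strongLimits {s : Set ((H →L[ℂ] H) × (H →L[ℂ] H))} {u : H}
    (h : ∀ p ∈ Submonoid.closure s, inner ℂ u (p.1 u) = inner ℂ u (p.2 u))
    {p : (H →L[ℂ] H) × (H →L[ℂ] H)} (hp : p ∈ strongLimits (Algebra.adjoin ℂ s)) :
    inner ℂ u (p.1 u) = inner ℂ u (p.2 u) := by
  have hadj : ∀ p ∈ Algebra.adjoin ℂ s, inner ℂ u (p.1 u) = inner ℂ u (p.2 u) := by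
    intro p hp
    have hp' : p ∈ Submodule.span ℂ (Submonoid.closure s : Set _) := by
      rw [← Algebra.adjoin_eq_span]; exact hp
    induction hp' using Submodule.span_induction with
    | mem x hx => exact h x hx
    | zero => simp
    | add x y hx hy ihx ihy =>
      simp only [Prod.fst_add, Prod.snd_add, add_apply, inner_add_right]
      rw [ihx (by rw [← Subalgebra.mem_toSubmodule, Algebra.adjoin_eq_span]; exact hx),
        ihy (by rw [← Subalgebra.mem_toSubmodule, Algebra.adjoin_eq_span]; exact hy)]
    | smul c x hx ih =>
      simp only [Prod.smul_fst, Prod.smul_snd, smul_apply, inner_smul_right]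
      rw [ih (by rw [← Subalgebra.mem_toSubmodule, Algebra.adjoin_eq_span]; exact hx)]
  obtain ⟨q, hq, -, hlim⟩ := hp
  have h1 : Tendsto (fun n => inner ℂ u ((q n).1 u)) atTop (𝓝 (inner ℂ u (p.1 u))) :=
    tendsto_const_nhds.inner (hlim u).1
  have h2 : Tendsto (fun n => inner ℂ u ((q n).2 u)) atTop (𝓝 (inner ℂ u (p.2 u))) :=
    tendsto_const_nhds.inner (hlim u).2
  refine tendsto_nhds_unique h1 (h2.congr (fun n => ?_))
  exact (hadj _ (hq n)).symm

variable {ι : Type*} (e : HilbertBasis ι ℂ H)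

theorem hasSum_norm_inner_sq (v : H) : HasSum (fun i => ‖inner ℂ (e i) v‖ ^ 2) (‖v‖ ^ 2) := by
  have h := e.hasSum_inner_mul_inner v v
  have h1 : inner ℂ v v = ((‖v‖ ^ 2 : ℝ) : ℂ) := by
    rw [inner_self_eq_norm_sq_to_K]
    push_cast
    rfl
  rw [h1] at h
  have h2 : ∀ i, inner ℂ v (e i) * inner ℂ (e i) v = ((‖inner ℂ (e i) v‖ ^ 2 : ℝ) : ℂ) := by
    intro i
    rw [← inner_conj_symm, mul_comm, Complex.mul_conj, Complex.normSq_eq_norm_sq]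
  simp only [h2] at h
  exact Complex.hasSum_ofReal.1 h

theorem inner_apply_of_diagonal {A : H →L[ℂ] H} {c : ι → ℂ} (hA : ∀ i, A (e i) = c i • e i)
    (i : ι) (v : H) : inner ℂ (e i) (A v) = c i * inner ℂ (e i) v := by
  have h : (innerSL ℂ (e i)) ∘L A = c i • innerSL ℂ (e i) := by
    apply ContinuousLinearMap.ext_on (s := Set.range e)
    · rw [Submodule.dense_iff_topologicalClosure_eq_top]
      exact e.dense_span
    · rintro - ⟨j, rfl⟩
      simp only [ContinuousLinearMap.comp_apply, innerSL_apply_apply, hA, inner_smul_right,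
        smul_apply, smul_eq_mul]
      classical
      rw [orthonormal_iff_ite.1 e.orthonormal i j]
      split_ifs with hij
      · rw [hij]
      · simp
  simpa using DFunLike.congr_fun h v

theorem norm_le_one_of_diagonal {A : H →L[ℂ] H} {c : ι → ℂ} (hA : ∀ i, A (e i) = c i • e i)
    (hc : ∀ i, ‖c i‖ ≤ 1) : ‖A‖ ≤ 1 := by
  refine A.opNorm_le_bound zero_le_one (fun v => ?_)
  rw [one_mul]
  refine (sq_le_sq₀ (norm_nonneg _) (norm_nonneg _)).1 ?_
  refine hasSum_le (fun i => ?_) (hasSum_norm_inner_sq e (A v)) (hasSum_norm_inner_sq e v)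
  rw [inner_apply_of_diagonal e hA, norm_mul]
  gcongr
  exact mul_le_of_le_one_left (norm_nonneg _) (hc i)

theorem pow_apply_of_diagonal {A : H →L[ℂ] H} {c : ι → ℂ} (hA : ∀ i, A (e i) = c i • e i)
    (n : ℕ) (i : ι) : (A ^ n) (e i) = c i ^ n • e i := by
  induction n with
  | zero => simp
  | succ n ih =>
    rw [pow_succ]
    change (A ^ n) (A (e i)) = _
    rw [hA, map_smul, ih, smul_smul, pow_succ, mul_comm]

/-- Diagonal operators whose eigenvalues are bounded and converge pointwise converge strongly. -/
theorem tendsto_of_diagonal {A : ℕ → H →L[ℂ] H} {L : H →L[ℂ] H} {c : ℕ → ι → ℂ} {d : ι → ℂ}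
    (hA : ∀ n i, A n (e i) = c n i • e i) (hL : ∀ i, L (e i) = d i • e i)
    (hc : ∀ n i, ‖c n i‖ ≤ 1) (hcd : ∀ i, Tendsto (fun n => c n i) atTop (𝓝 (d i))) (v : H) :
    Tendsto (fun n => A n v) atTop (𝓝 (L v)) := by
  have hd : ∀ i, ‖d i‖ ≤ 1 := fun i => le_of_tendsto (hcd i).norm (Eventually.of_forall (hc · i))
  have hinner : ∀ n i, inner ℂ (e i) (A n v - L v) = (c n i - d i) * inner ℂ (e i) v := by
    intro n i
    rw [inner_sub_right, inner_apply_of_diagonal e (hA n), inner_apply_of_diagonal e hL]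
    ring
  have hsq : Tendsto (fun n => ‖A n v - L v‖ ^ 2) atTop (𝓝 0) := by
    have h1 : ∀ n, ‖A n v - L v‖ ^ 2 = ∑' i, ‖(c n i - d i) * inner ℂ (e i) v‖ ^ 2 := by
      intro n
      rw [← (hasSum_norm_inner_sq e (A n v - L v)).tsum_eq]
      simp only [hinner]
    simp only [h1]
    have h2 := tendsto_tsum_of_dominated_convergence (𝓕 := atTop)
      (f := fun n i => ‖(c n i - d i) * inner ℂ (e i) v‖ ^ 2) (g := fun _ => (0 : ℝ))
      -- All eigenvalues have modulus at most one, so their differences are at most `2`; the `4` is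
      -- its square.
      (bound := fun i => 4 * ‖inner ℂ (e i) v‖ ^ 2)
      ((hasSum_norm_inner_sq e v).summable.mul_left 4) ?_ ?_
    · simpa using h2
    · intro i
      have := ((((hcd i).sub_const (d i)).mul_const (inner ℂ (e i) v)).norm).pow 2
      simpa using this
    · refine Eventually.of_forall (fun n i => ?_)
      rw [norm_pow, norm_norm, norm_mul, mul_pow]
      gcongr
      have : ‖c n i - d i‖ ≤ 2 := (norm_sub_le _ _).trans (by linarith [hc n i, hd i])
      nlinarith [norm_nonneg (c n i - d i)]
  rw [tendsto_iff_norm_sub_tendsto_zero]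
  have := hsq.sqrt
  simpa using this

/-- The diagonal operator with given eigenvalues of absolute value at most one exists. -/
theorem exists_diagonal {c : ι → ℂ} (hc : ∀ i, ‖c i‖ ≤ 1) :
    ∃ A : H →L[ℂ] H, ∀ i, A (e i) = c i • e i := by
  classical
  have hle : ∀ (v : lp (fun _ : ι => ℂ) 2) (i : ι), ‖c i * v i‖ ≤ ‖v i‖ := by
    intro v i
    rw [norm_mul]
    exact mul_le_of_le_one_left (norm_nonneg _) (hc i)
  have hmem : ∀ v : lp (fun _ : ι => ℂ) 2, Memℓp (fun i => c i * v i) 2 := fun v =>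
    (lp.memℓp v).mono' (hle v)
  let D : lp (fun _ : ι => ℂ) 2 →ₗ[ℂ] lp (fun _ : ι => ℂ) 2 :=
    { toFun := fun v => ⟨fun i => c i * v i, hmem v⟩
      map_add' := by
        intro v w
        ext i
        exact mul_add _ _ _
      map_smul' := by
        intro r v
        ext i
        simp [mul_left_comm] }
  let D' := D.mkContinuous 1 (by
    intro v
    rw [one_mul]
    exact lp.norm_mono two_ne_zero (hle v))
  refine ⟨e.repr.symm.toContinuousLinearEquiv.toContinuousLinearMap ∘L D' ∘L
    e.repr.toContinuousLinearEquiv.toContinuousLinearMap, fun i => ?_⟩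
  have h1 : D (lp.single 2 i 1) = c i • lp.single 2 i 1 := by
    ext j
    by_cases hij : j = i
    · subst hij; simp [D]
    · simp [D, hij]
  have h2 : e.repr (e i) = lp.single 2 i 1 := e.repr_self i
  simp only [ContinuousLinearMap.comp_apply]
  change e.repr.symm (D (e.repr (e i))) = _
  rw [h2, h1, map_smul, e.repr_symm_single]

/-- The product of operators along a word whose letters are `none`, standing for the operator `T`,
and `some c`, standing for the operator `M c`. -/
def wordOp {α : Type*} (M : α → H →L[ℂ] H) (T : H →L[ℂ] H) (w : List (Option α)) : H →L[ℂ] H :=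
  (w.map fun c => c.elim T M).prod

theorem exists_wordOp_of_mem_closure {M N T : H →L[ℂ] H} {p : (H →L[ℂ] H) × (H →L[ℂ] H)}
    (hp : p ∈ Submonoid.closure {(M, N), (T, T)}) :
    ∃ w : List (Option Unit), p = (wordOp (fun _ => M) T w, wordOp (fun _ => N) T w) := by
  induction hp using Submonoid.closure_induction with
  | mem x hx =>
    rcases hx with rfl | rfl
    · exact ⟨[some ()], by simp [wordOp]⟩
    · exact ⟨[none], by simp [wordOp]⟩
  | one => exact ⟨[], by simp [wordOp]; rfl⟩
  | mul x y _ _ hx hy =>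
    obtain ⟨w, rfl⟩ := hx
    obtain ⟨w', rfl⟩ := hy
    exact ⟨w ++ w', by simp [wordOp]⟩

variable (e : HilbertBasis ℤ ℂ H)

/-- The projection onto the frequencies `j` and `-j`. -/
noncomputable def freqProj (j : ℤ) : H →L[ℂ] H :=
  InnerProductSpace.rankOne ℂ (e j) (e j) + InnerProductSpace.rankOne ℂ (e (-j)) (e (-j))

theorem freqProj_apply (j : ℤ) (v : H) :
    freqProj e j v = inner ℂ (e j) v • e j + inner ℂ (e (-j)) v • e (-j) := by
  simp [freqProj]

theorem freqProj_apply_basis {j : ℤ} (hj : 0 < j) (k : ℤ) :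
    freqProj e j (e k) = (if k = j ∨ k = -j then 1 else 0 : ℂ) • e k := by
  rw [freqProj_apply, orthonormal_iff_ite.1 e.orthonormal, orthonormal_iff_ite.1 e.orthonormal]
  by_cases h1 : j = k
  · subst h1
    have : ¬ (-j = j) := by omega
    simp [this]
  · by_cases h2 : -j = k
    · subst h2
      simp [h1]
    · have h3 : ¬ (k = j ∨ k = -j) := by omega
      simp [h1, h2, h3]

/-- The operator `M Π_{j₁} M Π_{j₂} ⋯ M`. -/
noncomputable def pathOp (M : H →L[ℂ] H) : List ℤ → (H →L[ℂ] H)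
  | [] => M
  | j :: l => M * (freqProj e j * pathOp M l)

/-- Each projection restricts the intermediate frequency to `j` or `-j`, and a matrix entry of `M`
depends only on the increment; this is where the recursion for `pathCoeff` comes from. -/
theorem inner_pathOp {M : H →L[ℂ] H} {a : ℤ → ℂ}
    (hM : ∀ j k, inner ℂ (e j) (M (e k)) = a (j - k)) (l : List ℤ) (k : ℤ) :
    inner ℂ (e k) (pathOp e M l (e 0)) = pathCoeff a l k := by
  induction l generalizing k with
  | nil => simpa [pathOp, pathCoeff] using hM k 0
  | cons j l ih =>
    change inner ℂ (e k) (M (freqProj e j (pathOp e M l (e 0)))) = _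
    rw [freqProj_apply, map_add, map_smul, map_smul, inner_add_right, inner_smul_right,
      inner_smul_right, hM, hM, ih, ih, pathCoeff, sub_neg_eq_add]
    ring

/-- A polynomial in `T` with eigenvalue `1` at `±j` and eigenvalues in `[0, 1)` elsewhere has powers
converging strongly to the projection. Working with pairs ensures that the same polynomials serve
for `M` and for `N`. -/
theorem freqProj_mem_strongLimits {M N T : H →L[ℂ] H} {φ : ℤ → ℝ}
    (hT : ∀ k, T (e k) = (φ k : ℂ) • e k) (hφ : ∀ k, |φ k| ≤ 1) (heven : ∀ k, φ (-k) = φ k)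
    (hinj : ∀ j k, φ j = φ k → j = k ∨ j = -k) {j : ℤ} (hj : 0 < j) :
    (freqProj e j, freqProj e j) ∈
      strongLimits (Algebra.adjoin ℂ ({(M, N), (T, T)} : Set ((H →L[ℂ] H) × (H →L[ℂ] H)))) := by
  set S := Algebra.adjoin ℂ ({(M, N), (T, T)} : Set ((H →L[ℂ] H) × (H →L[ℂ] H)))
  -- The factor `1/4` keeps the eigenvalues nonnegative, because `|φ k - φ j| ≤ 2`.
  set B : H →L[ℂ] H := 1 - (1 / 4 : ℂ) • (T - (φ j : ℂ) • 1) ^ 2 with hB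
  set β : ℤ → ℝ := fun k => 1 - 1 / 4 * (φ k - φ j) ^ 2 with hβ
  have hBS : (B, B) ∈ S := by
    have hTS : (T, T) ∈ S := Algebra.subset_adjoin (by simp)
    have : (B, B) = 1 - (1 / 4 : ℂ) • ((T, T) - (φ j : ℂ) • 1) ^ 2 := rfl
    rw [this]
    exact S.sub_mem S.one_mem (S.smul_mem (S.pow_mem (S.sub_mem hTS (S.smul_mem S.one_mem _)) _) _)
  have hBe : ∀ k, B (e k) = (β k : ℂ) • e k := by
    intro k
    rw [hB]
    simp only [sub_apply, smul_apply]
    rw [pow_apply_of_diagonal e (c := fun k => (φ k : ℂ) - φ j) (fun k => by simp [hT, sub_smul])]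
    simp only [hβ]
    push_cast
    rw [sub_smul, one_smul, smul_smul]
    rfl
  have hβ0 : ∀ k, 0 ≤ β k := by
    intro k
    have h1 := abs_le.1 (hφ k)
    have h2 := abs_le.1 (hφ j)
    simp only [hβ]
    nlinarith
  have hβ1 : ∀ k, β k ≤ 1 := by
    intro k
    simp only [hβ]
    nlinarith [sq_nonneg (φ k - φ j)]
  have hβnorm : ∀ k, ‖(β k : ℂ)‖ ≤ 1 := by
    intro k
    rw [Complex.norm_real, Real.norm_of_nonneg (hβ0 k)]
    exact hβ1 k
  have hlim : ∀ v, Tendsto (fun n => (B ^ n) v) atTop (𝓝 (freqProj e j v)) := by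
    refine tendsto_of_diagonal e (c := fun n k => (β k : ℂ) ^ n)
      (fun n k => pow_apply_of_diagonal e hBe n k) (freqProj_apply_basis e hj)
      (fun n k => by rw [norm_pow]; exact pow_le_one₀ (norm_nonneg _) (hβnorm k)) (fun k => ?_)
    split_ifs with hk
    · have : β k = 1 := by
        rcases hk with rfl | rfl <;> simp [hβ, heven]
      simp [this]
    · apply tendsto_pow_atTop_nhds_zero_of_norm_lt_one
      rw [Complex.norm_real, Real.norm_of_nonneg (hβ0 k)]
      have hne : φ k - φ j ≠ 0 := fun h => hk (hinj k j (sub_eq_zero.1 h))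
      have : 0 < (φ k - φ j) ^ 2 := by positivity
      simp only [hβ]
      linarith
  refine ⟨fun n => (B, B) ^ n, fun n => S.pow_mem hBS n, ⟨1, fun n => ?_⟩, fun v => ⟨hlim v, hlim v⟩⟩
  have hn : ‖B ^ n‖ ≤ 1 := norm_le_one_of_diagonal e (c := fun k => (β k : ℂ) ^ n)
    (fun k => pow_apply_of_diagonal e hBe n k)
    (fun k => by rw [norm_pow]; exact pow_le_one₀ (norm_nonneg _) (hβnorm k))
  exact max_le hn hn

/-- If the vacuum expectations of all words in `M` and `T` agree with those of the words in
`N` and `T`, and the eigenvalues of `T` separate frequencies up to sign, then the path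
coefficients of the symbols of `M` and `N` agree. -/
theorem pathCoeff_eq_of_wordOp {M N T : H →L[ℂ] H} {φ : ℤ → ℝ}
    (hT : ∀ k, T (e k) = (φ k : ℂ) • e k) (hφ : ∀ k, |φ k| ≤ 1) (heven : ∀ k, φ (-k) = φ k)
    (hinj : ∀ j k, φ j = φ k → j = k ∨ j = -k) {a b : ℤ → ℂ}
    (hM : ∀ j k, inner ℂ (e j) (M (e k)) = a (j - k))
    (hN : ∀ j k, inner ℂ (e j) (N (e k)) = b (j - k))
    (hw : ∀ w : List (Option Unit), inner ℂ (e 0) (wordOp (fun _ => M) T w (e 0)) =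
      inner ℂ (e 0) (wordOp (fun _ => N) T w (e 0)))
    (l : List ℤ) (hl : ∀ j ∈ l, 0 < j) : pathCoeff a l 0 = pathCoeff b l 0 := by
  rw [← inner_pathOp e hM, ← inner_pathOp e hN]
  refine inner_eq_of_mem_strongLimits (s := {(M, N), (T, T)}) (p := (pathOp e M l, pathOp e N l))
    ?_ ?_
  · intro p hp
    obtain ⟨w, rfl⟩ := exists_wordOp_of_mem_closure hp
    exact hw w
  · have hMN : (M, N) ∈ strongLimits (Algebra.adjoin ℂ
        ({(M, N), (T, T)} : Set ((H →L[ℂ] H) × (H →L[ℂ] H)))) :=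
      mem_strongLimits_of_mem (Algebra.subset_adjoin (by simp))
    induction l with
    | nil => exact hMN
    | cons j l ih =>
      exact Submonoid.mul_mem _ hMN (Submonoid.mul_mem _
        (freqProj_mem_strongLimits e hT hφ heven hinj (hl j (by simp)))
        (ih (fun k hk => hl k (by simp [hk]))))

end Operators


/-! ### Cesàro means. -/

section Cesaro

/-- The arithmetic means of the sequence `u` converge to `c`. -/
def HasCesaro (u : ℕ → ℂ) (c : ℂ) : Prop :=
  Tendsto (fun N : ℕ => (N : ℂ)⁻¹ * ∑ n ∈ Finset.range N, u n) atTop (𝓝 c)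

variable {u v : ℕ → ℂ} {c d : ℂ}

theorem HasCesaro.congr (hu : HasCesaro u c) (h : ∀ n, u n = v n) : HasCesaro v c :=
  (funext h : u = v) ▸ hu

theorem HasCesaro.add (hu : HasCesaro u c) (hv : HasCesaro v d) :
    HasCesaro (fun n => u n + v n) (c + d) := by
  refine (Tendsto.add hu hv).congr (fun N => ?_)
  rw [Finset.sum_add_distrib, mul_add]

theorem HasCesaro.const_mul (r : ℂ) (hu : HasCesaro u c) :
    HasCesaro (fun n => r * u n) (r * c) := by
  refine (Tendsto.const_mul r hu).congr (fun N => ?_)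
  rw [← Finset.mul_sum]
  ring

theorem hasCesaro_const (c : ℂ) : HasCesaro (fun _ => c) c := by
  refine tendsto_const_nhds.congr' ?_
  filter_upwards [eventually_gt_atTop 0] with N hN
  have : (N : ℂ) ≠ 0 := by exact_mod_cast hN.ne'
  simp [this]

theorem HasCesaro.sub (hu : HasCesaro u c) (hv : HasCesaro v d) :
    HasCesaro (fun n => u n - v n) (c - d) := by
  simpa [sub_eq_add_neg] using hu.add (hv.const_mul (-1))

theorem norm_inv_mul_sum_le {C : ℝ} (N : ℕ) (hu : ∀ n, ‖u n‖ ≤ C) :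
    ‖(N : ℂ)⁻¹ * ∑ n ∈ Finset.range N, u n‖ ≤ C := by
  have hC : 0 ≤ C := (norm_nonneg _).trans (hu 0)
  rw [norm_mul, norm_inv, Complex.norm_natCast]
  have h1 : ‖∑ n ∈ Finset.range N, u n‖ ≤ N * C := by
    refine (norm_sum_le _ _).trans ((Finset.sum_le_sum fun n _ => hu n).trans ?_)
    simp
  rcases Nat.eq_zero_or_pos N with rfl | hN
  · simpa using hC
  · have : (0 : ℝ) < N := by exact_mod_cast hN
    calc (N : ℝ)⁻¹ * ‖∑ n ∈ Finset.range N, u n‖ ≤ (N : ℝ)⁻¹ * (N * C) := by gcongr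
      _ = C := by field_simp

theorem hasCesaro_succ_sub {C : ℝ} (hu : ∀ n, ‖u n‖ ≤ C) :
    HasCesaro (fun n => u (n + 1) - u n) 0 := by
  unfold HasCesaro
  have h1 : Tendsto (fun N : ℕ => (N : ℝ)⁻¹ * (2 * C)) atTop (𝓝 0) := by
    simpa using tendsto_inv_atTop_nhds_zero_nat.mul_const (2 * C)
  refine squeeze_zero_norm (fun N => ?_) h1
  rw [Finset.sum_range_sub, norm_mul, norm_inv, Complex.norm_natCast]
  gcongr
  exact (norm_sub_le _ _).trans (by linarith [hu N, hu 0])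

theorem HasCesaro.succ {C : ℝ} (hb : ∀ n, ‖u n‖ ≤ C) (hu : HasCesaro u c) :
    HasCesaro (fun n => u (n + 1)) c := by
  simpa using (hasCesaro_succ_sub hb).add hu

end Cesaro

/-! ### A strong law of large numbers for bounded orthogonal sequences. -/

section LLN

variable {Ω : Type*} [MeasurableSpace Ω] {P : Measure Ω} [IsProbabilityMeasure P]

/-- Orthogonality removes the off-diagonal terms. Growth linear in `N` makes the normalised second
moments summable along the squares. -/
theorem integral_norm_sum_sq_le {D : ℕ → Ω → ℂ} {C : ℝ} (hm : ∀ n, Measurable (D n))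
    (hC : ∀ n ω, ‖D n ω‖ ≤ C) (horth : ∀ m n, m < n → ∫ ω, D m ω * conj (D n ω) ∂P = 0) (N : ℕ) :
    ∫ ω, ‖∑ n ∈ Finset.range N, D n ω‖ ^ 2 ∂P ≤ N * C ^ 2 := by
  have hint : ∀ m n, Integrable (fun ω => D m ω * conj (D n ω)) P := by
    intro m n
    have h1 : Measurable fun ω => D m ω * conj (D n ω) :=
      (hm m).mul (Complex.continuous_conj.measurable.comp (hm n))
    refine Integrable.of_bound h1.aestronglyMeasurable (C * C) (Eventually.of_forall fun ω => ?_)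
    rw [norm_mul, RCLike.norm_conj]
    exact mul_le_mul (hC m ω) (hC n ω) (norm_nonneg _) ((norm_nonneg _).trans (hC m ω))
  have horth' : ∀ m n, m ≠ n → ∫ ω, D m ω * conj (D n ω) ∂P = 0 := by
    intro m n hmn
    rcases lt_or_gt_of_ne hmn with h | h
    · exact horth m n h
    · have h1 := congrArg conj (horth n m h)
      rw [← integral_conj] at h1
      simpa [mul_comm] using h1
  have h1 : ((∫ ω, ‖∑ n ∈ Finset.range N, D n ω‖ ^ 2 ∂P : ℝ) : ℂ)
      = ∑ n ∈ Finset.range N, ∫ ω, D n ω * conj (D n ω) ∂P := by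
    rw [← integral_complex_ofReal]
    have h2 : ∀ ω, ((‖∑ n ∈ Finset.range N, D n ω‖ ^ 2 : ℝ) : ℂ)
        = ∑ m ∈ Finset.range N, ∑ n ∈ Finset.range N, D m ω * conj (D n ω) := by
      intro ω
      rw [← Complex.normSq_eq_norm_sq, ← Complex.mul_conj, map_sum, Finset.sum_mul_sum]
    simp only [h2]
    rw [integral_finsetSum _ (fun m _ => integrable_finsetSum _ (fun n _ => hint m n))]
    refine Finset.sum_congr rfl (fun m hm => ?_)
    rw [integral_finsetSum _ (fun n _ => hint m n)]
    exact Finset.sum_eq_single m (fun n _ hn => horth' m n hn.symm) (fun h => absurd hm h)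
  have h3 : ‖((∫ ω, ‖∑ n ∈ Finset.range N, D n ω‖ ^ 2 ∂P : ℝ) : ℂ)‖ ≤ N * C ^ 2 := by
    rw [h1]
    refine (norm_sum_le _ _).trans ?_
    refine (Finset.sum_le_sum (g := fun _ => C ^ 2) fun n _ => ?_).trans (by simp)
    have := norm_integral_le_of_norm_le_const (μ := P) (f := fun ω => D n ω * conj (D n ω))
      (C := C ^ 2) (Eventually.of_forall fun ω => by
        rw [norm_mul, RCLike.norm_conj, ← sq]
        exact pow_le_pow_left₀ (norm_nonneg _) (hC n ω) 2)
    simpa using this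
  rw [Complex.norm_real] at h3
  exact (le_abs_self _).trans h3

/-- The strong law of large numbers for bounded orthogonal sequences. -/
theorem hasCesaro_zero_of_orthogonal {D : ℕ → Ω → ℂ} {C : ℝ} (hm : ∀ n, Measurable (D n))
    (hC : ∀ n ω, ‖D n ω‖ ≤ C) (horth : ∀ m n, m < n → ∫ ω, D m ω * conj (D n ω) ∂P = 0) :
    ∀ᵐ ω ∂P, HasCesaro (fun n => D n ω) 0 := by
  set S : ℕ → Ω → ℂ := fun N ω => ∑ n ∈ Finset.range N, D n ω with hS
  have hSm : ∀ N, Measurable (S N) := fun N => Finset.measurable_sum _ (fun n _ => hm n)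
  have hSle : ∀ N ω, ‖S N ω‖ ≤ N * C := fun N ω =>
    (norm_sum_le _ _).trans ((Finset.sum_le_sum fun n _ => hC n ω).trans (by simp))
  -- Along `N = j²` the expectations are at most `C² / j²`, so `∑ Z j` is almost surely finite and
  -- `Z j → 0`.
  set Z : ℕ → Ω → ℝ := fun j ω => (‖S (j ^ 2) ω‖ / (j ^ 2 : ℕ)) ^ 2 with hZ
  have hZm : ∀ j, Measurable (Z j) := fun j => ((hSm _).norm.div_const _).pow_const 2
  have hZint : ∀ j, Integrable (Z j) P := by
    intro j
    refine Integrable.of_bound (hZm j).aestronglyMeasurable (C ^ 2) (Eventually.of_forall fun ω => ?_)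
    have hC0 : 0 ≤ C := (norm_nonneg _).trans (hC 0 ω)
    rw [Real.norm_of_nonneg (sq_nonneg _)]
    refine pow_le_pow_left₀ (by positivity) ?_ 2
    exact div_le_of_le_mul₀ (by positivity) hC0 (by rw [mul_comm]; exact hSle _ ω)
  have hZle : ∀ j, ∫ ω, Z j ω ∂P ≤ C ^ 2 * (1 / (j : ℝ) ^ 2) := by
    intro j
    have h1 := integral_norm_sum_sq_le hm hC horth (j ^ 2)
    have h2 : ∫ ω, Z j ω ∂P = (∫ ω, ‖S (j ^ 2) ω‖ ^ 2 ∂P) / ((j ^ 2 : ℕ) : ℝ) ^ 2 := by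
      rw [← integral_div]
      simp only [hZ, div_pow]
    rw [h2]
    rcases Nat.eq_zero_or_pos j with rfl | hj
    · simp
    · have : (0 : ℝ) < j := by exact_mod_cast hj
      rw [div_le_iff₀ (by positivity)]
      refine h1.trans (le_of_eq ?_)
      push_cast
      field_simp
  have hsum : ∑' j, ∫⁻ ω, ENNReal.ofReal (Z j ω) ∂P ≠ ∞ := by
    have h1 : ∀ j, ∫⁻ ω, ENNReal.ofReal (Z j ω) ∂P ≤ ENNReal.ofReal (C ^ 2 * (1 / (j : ℝ) ^ 2)) := by
      intro j
      rw [← ofReal_integral_eq_lintegral_ofReal (hZint j)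
        (Eventually.of_forall fun ω => sq_nonneg _)]
      exact ENNReal.ofReal_le_ofReal (hZle j)
    refine ne_top_of_le_ne_top ?_ (ENNReal.tsum_le_tsum h1)
    have h2 : Summable fun j : ℕ => C ^ 2 * (1 / (j : ℝ) ^ 2) :=
      (Real.summable_one_div_nat_pow.2 one_lt_two).mul_left _
    rw [← ENNReal.ofReal_tsum_of_nonneg (fun j => by positivity) h2]
    exact ENNReal.ofReal_ne_top
  rw [← lintegral_tsum (fun j => (hZm j).ennreal_ofReal.aemeasurable)] at hsum
  filter_upwards [ae_lt_top (Measurable.tsum (fun j => (hZm j).ennreal_ofReal)) hsum] with ω hω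
  have hC0 : 0 ≤ C := (norm_nonneg _).trans (hC 0 ω)
  have h0 : Tendsto (fun j => Z j ω) atTop (𝓝 0) := by
    have h1 := ENNReal.tendsto_atTop_zero_of_tsum_ne_top hω.ne
    have h2 := (ENNReal.tendsto_toReal ENNReal.zero_ne_top).comp h1
    refine h2.congr (fun j => ?_)
    simp [hZ, ENNReal.toReal_ofReal, sq_nonneg]
  have h1 : Tendsto (fun j : ℕ => ‖S (j ^ 2) ω‖ / (j ^ 2 : ℕ)) atTop (𝓝 0) := by
    have := h0.sqrt
    simpa [hZ, Real.sqrt_sq_eq_abs, abs_div] using this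
  have hsqrt : Tendsto Nat.sqrt atTop atTop :=
    tendsto_atTop.2 fun b => by
      filter_upwards [eventually_ge_atTop (b * b)] with n hn
      exact Nat.le_sqrt.2 hn
  have h2 : Tendsto (fun N : ℕ => ‖S (N.sqrt ^ 2) ω‖ / (N.sqrt ^ 2 : ℕ) + 2 * C * (N.sqrt : ℝ)⁻¹)
      atTop (𝓝 0) := by
    have h3 := (tendsto_inv_atTop_nhds_zero_nat (𝕜 := ℝ)).comp hsqrt
    simpa using (h1.comp hsqrt).add (h3.const_mul (2 * C))
  unfold HasCesaro
  refine squeeze_zero_norm' ?_ h2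
  filter_upwards [eventually_ge_atTop 1] with N hN
  set j := N.sqrt with hj
  have hj1 : 1 ≤ j := Nat.le_sqrt.2 hN
  have hjN : j ^ 2 ≤ N := by rw [sq]; exact Nat.sqrt_le N
  have hNj : N ≤ j ^ 2 + 2 * j := by
    have := Nat.sqrt_le_add N
    rw [← hj] at this
    rw [sq]; omega
  -- Between consecutive squares there are at most `2j` extra bounded terms, negligible against
  -- `j²`.
  have hdiff : ‖S N ω‖ ≤ ‖S (j ^ 2) ω‖ + 2 * j * C := by
    have h4 : S N ω = S (j ^ 2) ω + ∑ n ∈ Finset.Ico (j ^ 2) N, D n ω :=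
      (Finset.sum_range_add_sum_Ico _ hjN).symm
    rw [h4]
    refine (norm_add_le _ _).trans (add_le_add le_rfl ?_)
    refine (norm_sum_le _ _).trans ((Finset.sum_le_sum fun n _ => hC n ω).trans ?_)
    rw [Finset.sum_const, Nat.card_Ico, nsmul_eq_mul]
    gcongr
    have : N - j ^ 2 ≤ 2 * j := by omega
    exact_mod_cast this
  have hj0 : (0 : ℝ) < j := by exact_mod_cast hj1
  have hjN' : ((j ^ 2 : ℕ) : ℝ) ≤ N := by exact_mod_cast hjN
  rw [norm_mul, norm_inv, Complex.norm_natCast, ← div_eq_inv_mul]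
  calc ‖S N ω‖ / N ≤ (‖S (j ^ 2) ω‖ + 2 * j * C) / (j ^ 2 : ℕ) := by gcongr
    _ = ‖S (j ^ 2) ω‖ / (j ^ 2 : ℕ) + 2 * C * (j : ℝ)⁻¹ := by
      push_cast
      field_simp

end LLN


/-! ### Multiplication operators on the circle. -/

section Multiplication

/-- The normalised Lebesgue measure on the circle. -/
noncomputable abbrev haar : Measure Circ := AddCircle.haarAddCircle

/-- The Hilbert space of square-integrable functions on the circle. -/
abbrev L2Circ : Type := Lp ℂ 2 haar

/-- Multiplication by an essentially bounded function. -/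
noncomputable def mulLp : Lp ℂ ∞ haar →L[ℂ] L2Circ →L[ℂ] L2Circ :=
  (ContinuousLinearMap.mul ℂ ℂ).holderL haar ∞ 2 2

/-- Multiplication by a continuous function. -/
noncomputable def mulC : C(Circ, ℂ) →L[ℂ] L2Circ →L[ℂ] L2Circ :=
  mulLp ∘L ContinuousMap.toLp ∞ haar ℂ

theorem coeFn_mulLp (g : Lp ℂ ∞ haar) (v : L2Circ) : mulLp g v =ᵐ[haar] fun x => g x * v x :=
  (ContinuousLinearMap.mul ℂ ℂ).coeFn_holder g v

theorem norm_mulLp_le (g : Lp ℂ ∞ haar) : ‖mulLp g‖ ≤ ‖g‖ := by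
  refine (mulLp g).opNorm_le_bound (norm_nonneg _) (fun v => ?_)
  refine ((ContinuousLinearMap.mul ℂ ℂ).norm_holder_apply_apply_le g v).trans ?_
  gcongr
  exact mul_le_of_le_one_left (norm_nonneg _) (ContinuousLinearMap.opNorm_mul_le ℂ ℂ)

theorem coeFn_fourierBasis (k : ℤ) : (fourierBasis k : L2Circ) =ᵐ[haar] fun x => fourier k x := by
  rw [coe_fourierBasis]
  exact coeFn_fourierLp 2 k

theorem inner_fourierBasis_mulLp (g : Lp ℂ ∞ haar) (j k : ℤ) :
    inner ℂ (fourierBasis j : L2Circ) (mulLp g (fourierBasis k)) = fourierCoeff g (j - k) := by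
  rw [L2.inner_def, fourierCoeff]
  apply integral_congr_ae
  filter_upwards [coeFn_mulLp g (fourierBasis k), coeFn_fourierBasis j, coeFn_fourierBasis k]
    with x h1 h2 h3
  rw [h1, h2, h3, RCLike.inner_apply, ← fourier_neg, neg_sub, sub_eq_add_neg, fourier_add,
    smul_eq_mul]
  ring

theorem mulC_fourier_apply (l k : ℤ) :
    mulC (fourier l) (fourierBasis k : L2Circ) = fourierBasis (l + k) := by
  apply Lp.ext
  have h0 := ContinuousMap.coeFn_toLp (p := ∞) (𝕜 := ℂ) haar (fourier l : C(Circ, ℂ))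
  filter_upwards [coeFn_mulLp (ContinuousMap.toLp ∞ haar ℂ (fourier l)) (fourierBasis k), h0,
    coeFn_fourierBasis k, coeFn_fourierBasis (l + k)] with x h1 h2 h3 h4
  change mulLp (ContinuousMap.toLp ∞ haar ℂ (fourier l)) (fourierBasis k) x = _
  rw [h1, h2, h3, h4, fourier_add]

theorem norm_L2_sq (v : L2Circ) : ‖v‖ ^ 2 = ∫ x, ‖v x‖ ^ 2 ∂haar := by
  have h1 : inner ℂ v v = ((‖v‖ ^ 2 : ℝ) : ℂ) := by
    rw [inner_self_eq_norm_sq_to_K]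
    push_cast
    rfl
  rw [L2.inner_def] at h1
  have h2 : ∀ x, inner ℂ (v x) (v x) = ((‖v x‖ ^ 2 : ℝ) : ℂ) := by
    intro x
    rw [inner_self_eq_norm_sq_to_K]
    push_cast
    rfl
  simp only [h2] at h1
  rw [integral_complex_ofReal] at h1
  exact_mod_cast h1.symm

/-- Multiplication operators by bounded functions that converge almost everywhere converge
strongly. -/
theorem tendsto_mulLp {g : ℕ → Lp ℂ ∞ haar} {g' : Lp ℂ ∞ haar} (hg : ∀ n, ∀ᵐ x ∂haar, ‖g n x‖ ≤ 1)
    (hlim : ∀ᵐ x ∂haar, Tendsto (fun n => g n x) atTop (𝓝 (g' x))) (v : L2Circ) :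
    Tendsto (fun n => mulLp (g n) v) atTop (𝓝 (mulLp g' v)) := by
  have hint : Integrable (fun x => ‖v x‖ ^ 2) haar := (Lp.memLp v).integrable_norm_pow two_ne_zero
  have h1 : ∀ n, ‖mulLp (g n) v - mulLp g' v‖ ^ 2 = ∫ x, ‖(g n x - g' x) * v x‖ ^ 2 ∂haar := by
    intro n
    rw [norm_L2_sq]
    apply integral_congr_ae
    filter_upwards [coeFn_mulLp (g n) v, coeFn_mulLp g' v,
      Lp.coeFn_sub (mulLp (g n) v) (mulLp g' v)] with x h2 h3 h4
    rw [h4, Pi.sub_apply, h2, h3, sub_mul]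
  have h2 : Tendsto (fun n => ‖mulLp (g n) v - mulLp g' v‖ ^ 2) atTop (𝓝 0) := by
    simp only [h1]
    have h3 := tendsto_integral_of_dominated_convergence (μ := haar)
      (F := fun n x => ‖(g n x - g' x) * v x‖ ^ 2) (f := fun _ => (0 : ℝ))
      (fun x => 4 * ‖v x‖ ^ 2) ?_ (hint.const_mul 4) ?_ ?_
    · simpa using h3
    · intro n
      exact ((((Lp.aestronglyMeasurable (g n)).sub (Lp.aestronglyMeasurable g')).mul
        (Lp.aestronglyMeasurable v)).norm.pow 2)
    · intro n
      filter_upwards [ae_all_iff.2 hg, hlim] with x h4 h5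
      have h6 : ‖g' x‖ ≤ 1 := le_of_tendsto h5.norm (Eventually.of_forall h4)
      rw [norm_pow, norm_norm, norm_mul, mul_pow]
      gcongr
      have : ‖g n x - g' x‖ ≤ 2 := (norm_sub_le _ _).trans (by linarith [h4 n])
      nlinarith [norm_nonneg (g n x - g' x)]
    · filter_upwards [hlim] with x h5
      have := ((h5.sub_const (g' x)).mul_const (v x)).norm.pow 2
      simpa using this
  rw [tendsto_iff_norm_sub_tendsto_zero]
  have := h2.sqrt
  simpa using this

/-- The multiplication operators are contractions, so strong convergence passes through products
letter by letter. This carries the ergodic averages from continuous functions to indicators. -/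
theorem tendsto_wordOp {α : Type*} {g : ℕ → Lp ℂ ∞ haar} {g' : Lp ℂ ∞ haar}
    (hg : ∀ n, ∀ᵐ x ∂haar, ‖g n x‖ ≤ 1)
    (hlim : ∀ᵐ x ∂haar, Tendsto (fun n => g n x) atTop (𝓝 (g' x))) (T : L2Circ →L[ℂ] L2Circ)
    (w : List (Option α)) (v : L2Circ) :
    Tendsto (fun n => wordOp (fun _ => mulLp (g n)) T w v) atTop
      (𝓝 (wordOp (fun _ => mulLp g') T w v)) := by
  induction w generalizing v with
  | nil => exact tendsto_const_nhds
  | cons c w ih =>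
    cases c with
    | none => exact (T.continuous.tendsto _).comp (ih v)
    | some c =>
      refine tendsto_mul_apply (C := 1) (A := fun n => mulLp (g n))
        (A' := fun n => wordOp (fun _ => mulLp (g n)) T w) (fun n => ?_) (tendsto_mulLp hg hlim) ih v
      refine (norm_mulLp_le _).trans ?_
      rw [Lp.norm_def]
      have : eLpNorm (g n) ∞ haar ≤ 1 := by
        rw [eLpNorm_exponent_top]
        refine eLpNormEssSup_le_of_ae_enorm_bound ?_
        filter_upwards [hg n] with x hx
        rw [← ofReal_norm]
        exact ENNReal.ofReal_le_one.2 hx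
      simpa using ENNReal.toReal_mono ENNReal.one_ne_top this

end Multiplication

/-! ### Reading a sequence along a word. -/

section Words

variable {α β : Type*}

/-- The product of the functions of a sequence `x` read off along a word: a letter `none` moves one
step ahead in the sequence, a letter `some c` contributes the value of the function `F c`. -/
def wordEval {E : Type*} (F : α → E → ℂ) (x : ℕ → E) : List (Option α) → ℕ → ℂ
  | [], _ => 1
  | none :: w, n => wordEval F x w (n + 1)
  | some c :: w, n => F c (x n) * wordEval F x w n

/-- The number of steps taken along a word. -/
def steps : List (Option α) → ℕ
  | [] => 0
  | none :: w => steps w + 1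
  | some _ :: w => steps w

variable {F : α → Circ → ℂ} {x : ℕ → Circ}

theorem wordEval_append (w w' : List (Option α)) (n : ℕ) :
    wordEval F x (w ++ w') n = wordEval F x w n * wordEval F x w' (n + steps w) := by
  induction w generalizing n with
  | nil => simp [wordEval, steps]
  | cons c w ih =>
    cases c with
    | none =>
      simp only [List.cons_append, wordEval, steps, ih]
      rw [show n + 1 + steps w = n + (steps w + 1) by ring]
    | some c => simp only [List.cons_append, wordEval, steps, ih, mul_assoc]

theorem steps_append (w w' : List (Option α)) : steps (w ++ w') = steps w + steps w' := by
  induction w with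
  | nil => simp [steps]
  | cons c w ih =>
    cases c with
    | none => simp only [List.cons_append, steps, ih]; omega
    | some c => simp only [List.cons_append, steps, ih]

theorem wordEval_map (f : β → α) (w : List (Option β)) (n : ℕ) :
    wordEval F x (w.map (Option.map f)) n = wordEval (fun c => F (f c)) x w n := by
  induction w generalizing n with
  | nil => rfl
  | cons c w ih => cases c <;> simp [wordEval, ih]

theorem exists_norm_wordEval_le (hF : ∀ c, ∃ C, ∀ y, ‖F c y‖ ≤ C) (w : List (Option α)) :
    ∃ C, ∀ n, ‖wordEval F x w n‖ ≤ C := by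
  induction w with
  | nil => exact ⟨1, fun n => by simp [wordEval]⟩
  | cons c w ih =>
    obtain ⟨C, hC⟩ := ih
    cases c with
    | none => exact ⟨C, fun n => hC (n + 1)⟩
    | some c =>
      obtain ⟨C', hC'⟩ := hF c
      refine ⟨C' * C, fun n => ?_⟩
      simp only [wordEval, norm_mul]
      exact mul_le_mul (hC' _) (hC n) (norm_nonneg _) ((norm_nonneg _).trans (hC' (x n)))

theorem norm_wordEval_le_one (hF : ∀ c y, ‖F c y‖ ≤ 1) (w : List (Option α)) (n : ℕ) :
    ‖wordEval F x w n‖ ≤ 1 := by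
  induction w generalizing n with
  | nil => simp [wordEval]
  | cons c w ih =>
    cases c with
    | none => exact ih (n + 1)
    | some c =>
      simp only [wordEval, norm_mul]
      exact mul_le_one₀ (hF _ _) (norm_nonneg _) (ih n)

variable {H : Type*} [NormedAddCommGroup H] [InnerProductSpace ℂ H]

theorem wordOp_append (M : α → H →L[ℂ] H) (T : H →L[ℂ] H) (w w' : List (Option α)) :
    wordOp M T (w ++ w') = wordOp M T w * wordOp M T w' := by
  simp [wordOp]

theorem wordOp_map (M : α → H →L[ℂ] H) (T : H →L[ℂ] H) (f : β → α) (w : List (Option β)) :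
    wordOp M T (w.map (Option.map f)) = wordOp (fun c => M (f c)) T w := by
  simp only [wordOp, List.map_map]
  congr 2
  funext c
  cases c <;> rfl

end Words

/-! ### From characters to continuous functions in the ergodic averages. -/

section Ergodic

/-- The averages along the sequence `x` of products of continuous functions are those of a
stationary random walk with transition operator `T`. -/
def IsErgodicSeq (T : L2Circ →L[ℂ] L2Circ) (x : ℕ → Circ) : Prop :=
  ∀ w : List (Option C(Circ, ℂ)), HasCesaro (wordEval (fun g : C(Circ, ℂ) => g) x w)
    (inner ℂ (fourierBasis 0 : L2Circ) (wordOp mulC T w (fourierBasis 0)))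

variable {T : L2Circ →L[ℂ] L2Circ} {x : ℕ → Circ} {φ : ℤ → ℂ}

/-- Peel the word from its right end, where the operators act first, keeping a trailing character. A
step replaces the character by `φ k` times its value one time earlier, up to a martingale difference
that averages out; a reading by a character just shifts its frequency. -/
theorem hasCesaro_wordEval_fourier (hT : ∀ k, T (fourierBasis k) = φ k • fourierBasis k)
    (hφ : ∀ k, k ≠ 0 → φ k ≠ 1)
    (h : ∀ (w : List (Option ℤ)) (k : ℤ), HasCesaro (fun n =>
      wordEval (fun k => fourier k) x w n *
        (fourier k (x (n + steps w + 1)) - φ k * fourier k (x (n + steps w)))) 0)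
    (w : List (Option ℤ)) (k : ℤ) :
    HasCesaro (fun n => wordEval (fun k => fourier k) x w n * fourier k (x (n + steps w)))
      (inner ℂ (fourierBasis 0 : L2Circ)
        (wordOp (fun k => mulC (fourier k)) T w (fourierBasis k))) := by
  induction w using List.reverseRecOn generalizing k with
  | nil =>
    have horth : inner ℂ (fourierBasis 0 : L2Circ) (fourierBasis k) = if 0 = k then 1 else 0 :=
      orthonormal_iff_ite.1 (fourierBasis (T := 2 * π)).orthonormal 0 k
    simp only [wordOp, List.map_nil, List.prod_nil, wordEval, steps, one_mul, add_zero]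
    change HasCesaro _ (inner ℂ (fourierBasis 0 : L2Circ) (fourierBasis k))
    rw [horth]
    rcases eq_or_ne k 0 with rfl | hk
    · simpa using hasCesaro_const 1
    · rw [if_neg hk.symm]
      have h1 := h [] k
      simp only [wordEval, steps, one_mul, add_zero] at h1
      have hb : ∀ n, ‖fourier k (x n)‖ ≤ 1 := fun n => by
        rw [fourier_apply, Circle.norm_coe]
      have h2 := (hasCesaro_succ_sub hb).sub h1
      have h3 := h2.const_mul (φ k - 1)⁻¹
      have h4 : φ k - 1 ≠ 0 := sub_ne_zero.2 (hφ k hk)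
      simp only [sub_zero, mul_zero] at h3
      -- A telescoping difference minus a martingale difference equals `(φ k - 1)` times the
      -- character, so nontrivial characters average to zero.
      refine HasCesaro.congr h3 (fun n => ?_)
      field_simp
      ring
  | append_singleton w c ih =>
    cases c with
    | none =>
      have h1 := (h w k).add ((ih k).const_mul (φ k))
      have e1 : wordOp (fun k => mulC (fourier k)) T (w ++ [none]) (fourierBasis k)
          = φ k • wordOp (fun k => mulC (fourier k)) T w (fourierBasis k) := by
        rw [wordOp_append, ← map_smul, ← hT]
        simp [wordOp]
      rw [e1, inner_smul_right, ← zero_add (φ k * _)]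
      refine HasCesaro.congr h1 (fun n => ?_)
      rw [wordEval_append, steps_append]
      simp only [wordEval, steps]
      rw [← add_assoc]
      ring
    | some l =>
      have e1 : wordOp (fun k => mulC (fourier k)) T (w ++ [some l]) (fourierBasis k)
          = wordOp (fun k => mulC (fourier k)) T w (fourierBasis (l + k)) := by
        rw [wordOp_append, ← mulC_fourier_apply]
        simp [wordOp]
      rw [e1]
      refine HasCesaro.congr (ih (l + k)) (fun n => ?_)
      rw [wordEval_append, steps_append]
      simp only [wordEval, steps, add_zero, fourier_add]
      ring

/-- Uniformly Lipschitz families are equicontinuous, so convergence survives limits of the argument;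
this powers the density argument for continuous functions. -/
theorem isClosed_setOf_tendsto {V : Type*} [PseudoMetricSpace V] {A : ℕ → V → ℂ} {B : V → ℂ}
    {C : ℝ} (hA : ∀ n v v', dist (A n v) (A n v') ≤ C * dist v v') (hB : Continuous B) :
    IsClosed {v | Tendsto (fun n => A n v) atTop (𝓝 (B v))} := by
  have heq : Equicontinuous A := by
    refine Metric.equicontinuous_of_continuity_modulus (fun t => C * t) ?_ A
      (fun v v' n => hA n v v')
    have : Continuous fun t : ℝ => C * t := by fun_prop
    simpa using this.tendsto 0
  exact heq.isClosed_setOfPred_tendsto hB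

/-- It suffices to test ergodicity on martingale differences built from characters. -/
theorem isErgodicSeq_of_fourier (hT : ∀ k, T (fourierBasis k) = φ k • fourierBasis k)
    (hφ : ∀ k, k ≠ 0 → φ k ≠ 1)
    (h : ∀ (w : List (Option ℤ)) (k : ℤ), HasCesaro (fun n =>
      wordEval (fun k => fourier k) x w n *
        (fourier k (x (n + steps w + 1)) - φ k * fourier k (x (n + steps w)))) 0) :
    IsErgodicSeq T x := by
  have hbd : ∀ g : C(Circ, ℂ), ∃ C, ∀ y, ‖g y‖ ≤ C := fun g => ⟨‖g‖, g.norm_coe_le_norm⟩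
  have key : ∀ (w : List (Option C(Circ, ℂ))) (w' : List (Option ℤ)),
      HasCesaro (wordEval (fun g : C(Circ, ℂ) => g) x (w ++ w'.map (Option.map fourier)))
        (inner ℂ (fourierBasis 0 : L2Circ)
          (wordOp mulC T (w ++ w'.map (Option.map fourier)) (fourierBasis 0))) := by
    intro w
    induction w using List.reverseRecOn with
    | nil =>
      intro w'
      have h1 := hasCesaro_wordEval_fourier hT hφ h w' 0
      simp only [List.nil_append, wordOp_map]
      refine HasCesaro.congr h1 (fun n => ?_)
      rw [wordEval_map]
      simp
    | append_singleton w c ih =>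
      intro w'
      cases c with
      | none => simpa using ih (none :: w')
      | some g =>
        simp only [List.append_assoc, List.singleton_append]
        set W := w'.map (Option.map (fourier : ℤ → C(Circ, ℂ))) with hW
        obtain ⟨C₁, hC₁⟩ := exists_norm_wordEval_le (x := x) hbd w
        obtain ⟨C₂, hC₂⟩ := exists_norm_wordEval_le (x := x) hbd W
        have hev : ∀ (g : C(Circ, ℂ)) n, wordEval (fun g : C(Circ, ℂ) => g) x (w ++ some g :: W) n
            = wordEval (fun g : C(Circ, ℂ) => g) x w n * (g (x (n + steps w)) *
              wordEval (fun g : C(Circ, ℂ) => g) x W (n + steps w)) := by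
          intro g n
          rw [wordEval_append]
          rfl
        have hop : ∀ g : C(Circ, ℂ), wordOp mulC T (w ++ some g :: W) (fourierBasis 0)
            = wordOp mulC T w (mulC g (wordOp mulC T W (fourierBasis 0))) := by
          intro g
          rw [wordOp_append]
          rfl
        -- With the other letters fixed, the admissible `g` form a closed subspace. It contains the
        -- characters by the induction hypothesis, which lets the character suffix grow, so it is
        -- everything.
        set s : Submodule ℂ C(Circ, ℂ) :=
          { carrier := {g | HasCesaro (wordEval (fun g : C(Circ, ℂ) => g) x (w ++ some g :: W))
              (inner ℂ (fourierBasis 0 : L2Circ)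
                (wordOp mulC T (w ++ some g :: W) (fourierBasis 0)))}
            add_mem' := by
              intro g g' hg hg'
              have h1 := HasCesaro.add hg hg'
              simp only [Set.mem_ofPred_eq, hop, map_add, add_apply, inner_add_right] at h1 ⊢
              refine HasCesaro.congr h1 (fun n => ?_)
              simp only [hev, ContinuousMap.add_apply]
              ring
            zero_mem' := by
              have h1 := hasCesaro_const 0
              simp only [Set.mem_ofPred_eq, hop, map_zero, zero_apply, inner_zero_right] at h1 ⊢
              refine HasCesaro.congr h1 (fun n => ?_)
              simp [hev]
            smul_mem' := by
              intro r g hg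
              have h1 := HasCesaro.const_mul r hg
              simp only [Set.mem_ofPred_eq, hop, map_smul, smul_apply, inner_smul_right] at h1 ⊢
              refine HasCesaro.congr h1 (fun n => ?_)
              simp only [hev, ContinuousMap.smul_apply, smul_eq_mul]
              ring } with hs
        have hclosed : IsClosed (s : Set C(Circ, ℂ)) := by
          refine isClosed_setOf_tendsto (C := C₁ * C₂) (A := fun N (g : C(Circ, ℂ)) => (N : ℂ)⁻¹ *
            ∑ n ∈ Finset.range N, wordEval (fun g : C(Circ, ℂ) => g) x (w ++ some g :: W) n)
            (B := fun g => inner ℂ (fourierBasis 0 : L2Circ)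
                (wordOp mulC T (w ++ some g :: W) (fourierBasis 0))) ?_ ?_
          · intro N g g'
            rw [dist_eq_norm, dist_eq_norm, ← mul_sub, ← Finset.sum_sub_distrib]
            refine norm_inv_mul_sum_le (u := fun n =>
              wordEval (fun g : C(Circ, ℂ) => g) x (w ++ some g :: W) n -
              wordEval (fun g : C(Circ, ℂ) => g) x (w ++ some g' :: W) n) N (fun n => ?_)
            rw [hev, hev, ← mul_sub, ← sub_mul, norm_mul, norm_mul]
            have h1 : ‖g (x (n + steps w)) - g' (x (n + steps w))‖ ≤ ‖g - g'‖ :=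
              (g - g').norm_coe_le_norm _
            have h2 := hC₁ n
            have h3 := hC₂ (n + steps w)
            have h4 : 0 ≤ C₁ := (norm_nonneg _).trans h2
            calc _ ≤ C₁ * (‖g - g'‖ * C₂) := by gcongr
              _ = C₁ * C₂ * ‖g - g'‖ := by ring
          · simp only [hop]
            fun_prop
        have hspan : Submodule.span ℂ (Set.range (fourier : ℤ → C(Circ, ℂ))) ≤ s := by
          rw [Submodule.span_le]
          rintro - ⟨k, rfl⟩
          exact ih (some k :: w')
        have htop := Submodule.topologicalClosure_minimal _ hspan hclosed
        rw [span_fourier_closure_eq_top] at htop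
        exact htop Submodule.mem_top
  intro w
  simpa using key w []

end Ergodic


/-! ### From continuous to Riemann integrable functions. -/

section Sandwich

/-- The sum of the values of `K` read off along a word. -/
def wordSum (K : Circ → ℂ) (x : ℕ → Circ) {α : Type*} : List (Option α) → ℕ → ℂ
  | [], _ => 0
  | none :: w, n => wordSum K x w (n + 1)
  | some _ :: w, n => K (x n) + wordSum K x w n

/-- The number of readings along a word. -/
def readings {α : Type*} : List (Option α) → ℕ
  | [] => 0
  | none :: w => readings w
  | some _ :: w => readings w + 1

variable {T : L2Circ →L[ℂ] L2Circ} {x : ℕ → Circ}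

theorem IsErgodicSeq.hasCesaro (hx : IsErgodicSeq T x) (K : C(Circ, ℂ)) :
    HasCesaro (fun n => K (x n)) (∫ y, K y ∂haar) := by
  have h1 := hx [some K]
  have h2 : inner ℂ (fourierBasis 0 : L2Circ) (wordOp mulC T [some K] (fourierBasis 0))
      = ∫ y, K y ∂haar := by
    have h3 : wordOp mulC T [some K] = mulLp (ContinuousMap.toLp ∞ haar ℂ K) := by
      simp [wordOp, mulC]
    rw [h3, inner_fourierBasis_mulLp, sub_zero,
      fourierCoeff_congr_ae (ContinuousMap.coeFn_toLp haar K)]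
    simp [fourierCoeff]
  rw [h2] at h1
  exact h1.congr (fun n => by simp [wordEval])

theorem norm_wordSum_le {α : Type*} {K : Circ → ℂ} {C : ℝ} (hK : ∀ y, ‖K y‖ ≤ C)
    (w : List (Option α)) (n : ℕ) : ‖wordSum K x w n‖ ≤ readings w * C := by
  induction w generalizing n with
  | nil => simp [wordSum, readings]
  | cons c w ih =>
    cases c with
    | none => exact ih (n + 1)
    | some c =>
      simp only [wordSum, readings]
      push_cast
      rw [add_mul, one_mul, add_comm]
      exact (norm_add_le _ _).trans (by linarith [hK (x n), ih n])

theorem IsErgodicSeq.hasCesaro_wordSum (hx : IsErgodicSeq T x) {α : Type*} (K : C(Circ, ℂ))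
    (w : List (Option α)) :
    HasCesaro (wordSum K x w) (readings w * ∫ y, K y ∂haar) := by
  induction w with
  | nil => simpa [readings] using! hasCesaro_const 0
  | cons c w ih =>
    cases c with
    | none => exact ih.succ (norm_wordSum_le K.norm_coe_le_norm w)
    | some c =>
      have h1 := (hx.hasCesaro K).add ih
      simp only [readings]
      push_cast
      rw [add_mul, one_mul, add_comm]
      exact h1

/-- Replace the factors one at a time; all others have modulus at most one. The bound is linear in
the continuous `K`, so its averages are known. -/
theorem norm_wordEval_sub_le {α : Type*} {f h K : Circ → ℂ} (hf : ∀ y, ‖f y‖ ≤ 1)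
    (hh : ∀ y, ‖h y‖ ≤ 1) (hK : ∀ y, ‖f y - h y‖ ≤ (K y).re) (w : List (Option α)) (n : ℕ) :
    ‖wordEval (fun _ => f) x w n - wordEval (fun _ => h) x w n‖ ≤ (wordSum K x w n).re := by
  induction w generalizing n with
  | nil => simp [wordEval, wordSum]
  | cons c w ih =>
    cases c with
    | none => exact ih (n + 1)
    | some c =>
      simp only [wordEval, wordSum, Complex.add_re]
      have h1 : f (x n) * wordEval (fun _ : α => f) x w n - h (x n) * wordEval (fun _ : α => h) x w n
          = (f (x n) - h (x n)) * wordEval (fun _ : α => f) x w n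
            + h (x n) * (wordEval (fun _ : α => f) x w n - wordEval (fun _ : α => h) x w n) := by
        ring
      rw [h1]
      refine (norm_add_le _ _).trans (add_le_add ?_ ?_)
      · rw [norm_mul]
        exact (mul_le_of_le_one_right (norm_nonneg _)
          (norm_wordEval_le_one (fun _ => hf) w n)).trans (hK _)
      · rw [norm_mul]
        exact (mul_le_of_le_one_left (norm_nonneg _) (hh _)).trans (ih n)

/-- Averages along an ergodic sequence of products of values of a function that is Riemann
integrable, in the sense that it is squeezed by continuous functions. -/
theorem IsErgodicSeq.hasCesaro_wordEval (hx : IsErgodicSeq T x) {f : Circ → ℂ}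
    (hfm : MemLp f ∞ haar) (hf : ∀ y, ‖f y‖ ≤ 1) {h K : ℕ → C(Circ, ℂ)}
    (hh : ∀ m y, ‖h m y‖ ≤ 1) (hK : ∀ m y, ‖f y - h m y‖ ≤ (K m y).re)
    (hK0 : Tendsto (fun m => ∫ y, K m y ∂haar) atTop (𝓝 0))
    (hlim : ∀ᵐ y ∂haar, Tendsto (fun m => h m y) atTop (𝓝 (f y))) (w : List (Option Unit)) :
    HasCesaro (wordEval (fun _ => f) x w)
      (inner ℂ (fourierBasis 0 : L2Circ)
        (wordOp (fun _ => mulLp hfm.toLp) T w (fourierBasis 0))) := by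
  have hH : ∀ m, HasCesaro (wordEval (fun _ => h m) x w) (inner ℂ (fourierBasis 0 : L2Circ)
      (wordOp (fun _ => mulC (h m)) T w (fourierBasis 0))) := by
    intro m
    have h1 := hx (w.map (Option.map fun _ => h m))
    rw [wordOp_map] at h1
    exact h1.congr (fun n => wordEval_map _ _ _)
  have hL : Tendsto (fun m => inner ℂ (fourierBasis 0 : L2Circ)
      (wordOp (fun _ => mulC (h m)) T w (fourierBasis 0))) atTop
      (𝓝 (inner ℂ (fourierBasis 0 : L2Circ)
        (wordOp (fun _ => mulLp hfm.toLp) T w (fourierBasis 0)))) := by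
    have hae : ∀ᵐ y ∂haar, ∀ m, (ContinuousMap.toLp ∞ haar ℂ (h m)) y = h m y :=
      ae_all_iff.2 fun m => ContinuousMap.coeFn_toLp haar (h m)
    refine tendsto_const_nhds.inner (tendsto_wordOp (g := fun m => ContinuousMap.toLp ∞ haar ℂ (h m))
      (fun m => ?_) ?_ T w _)
    · filter_upwards [hae] with y hy
      rw [hy]
      exact hh m y
    · filter_upwards [hae, hlim, hfm.coeFn_toLp] with y h1 h2 h3
      rw [h3]
      exact h2.congr (fun m => (h1 m).symm)
  set L : ℂ := inner ℂ (fourierBasis 0 : L2Circ)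
    (wordOp (fun _ => mulLp hfm.toLp) T w (fourierBasis 0))
  have hKw : Tendsto (fun m => (readings w * ∫ y, K m y ∂haar : ℂ)) atTop (𝓝 0) := by
    simpa using hK0.const_mul (readings w : ℂ)
  unfold HasCesaro
  rw [Metric.tendsto_atTop]
  intro ε hε
  -- The approximation `m` is fixed before `N`, since the averages need not converge uniformly in
  -- `m`.
  obtain ⟨m, hm1, hm2⟩ := ((Metric.tendsto_nhds.1 hL (ε / 4) (by positivity)).and
    (Metric.tendsto_nhds.1 hKw (ε / 4) (by positivity))).exists
  obtain ⟨N₁, hN₁⟩ := Metric.tendsto_atTop.1 (hH m) (ε / 4) (by positivity)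
  obtain ⟨N₂, hN₂⟩ := Metric.tendsto_atTop.1 (hx.hasCesaro_wordSum (K m) w) (ε / 4) (by positivity)
  refine ⟨max N₁ N₂, fun N hN => ?_⟩
  have h1 := hN₁ N ((le_max_left _ _).trans hN)
  have h2 := hN₂ N ((le_max_right _ _).trans hN)
  have h3 : dist ((N : ℂ)⁻¹ * ∑ n ∈ Finset.range N, wordEval (fun _ => f) x w n)
      ((N : ℂ)⁻¹ * ∑ n ∈ Finset.range N, wordEval (fun _ => h m) x w n)
      ≤ ‖(N : ℂ)⁻¹ * ∑ n ∈ Finset.range N, wordSum (K m) x w n‖ := by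
    rw [dist_eq_norm, ← mul_sub, norm_mul, norm_mul, ← Finset.sum_sub_distrib]
    gcongr
    refine (norm_sum_le _ _).trans ?_
    refine (Finset.sum_le_sum fun n _ => norm_wordEval_sub_le hf (hh m) (hK m) w n).trans ?_
    rw [← Complex.re_sum]
    exact Complex.re_le_norm _
  have h4 : ‖(N : ℂ)⁻¹ * ∑ n ∈ Finset.range N, wordSum (K m) x w n‖ < ε / 2 := by
    rw [dist_zero_right] at hm2
    rw [dist_eq_norm] at h2
    have := norm_le_norm_add_norm_sub
      (readings w * ∫ y, K m y ∂haar : ℂ) ((N : ℂ)⁻¹ * ∑ n ∈ Finset.range N, wordSum (K m) x w n)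
    rw [norm_sub_rev] at this
    linarith
  have h5 := dist_triangle4 ((N : ℂ)⁻¹ * ∑ n ∈ Finset.range N, wordEval (fun _ => f) x w n)
    ((N : ℂ)⁻¹ * ∑ n ∈ Finset.range N, wordEval (fun _ => h m) x w n)
    (inner ℂ (fourierBasis 0 : L2Circ) (wordOp (fun _ => mulC (h m)) T w (fourierBasis 0))) L
  linarith

end Sandwich

/-! ### Squeezing indicators of open sets with null boundary. -/

section Indicator

/-- The indicator function of a set, with complex values. -/
noncomputable def indC (U : Set Circ) : Circ → ℂ := U.indicator fun _ => 1

theorem norm_indC_le (U : Set Circ) (y : Circ) : ‖indC U y‖ ≤ 1 := by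
  unfold indC
  by_cases h : y ∈ U <;> simp [h]

theorem memLp_indC {U : Set Circ} (hU : IsOpen U) : MemLp (indC U) ∞ haar :=
  memLp_top_of_bound ((measurable_const.indicator hU.measurableSet).aestronglyMeasurable) 1
    (Eventually.of_forall (norm_indC_le U))

theorem haar_absolutelyContinuous : haar ≪ (volume : Measure Circ) := by
  rw [AddCircle.volume_eq_smul_haarAddCircle]
  exact Measure.absolutelyContinuous_smul (by simp [Real.pi_pos])

theorem volume_absolutelyContinuous : (volume : Measure Circ) ≪ haar := by
  rw [AddCircle.volume_eq_smul_haarAddCircle]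
  exact Measure.smul_absolutelyContinuous

/-- The indicator function of an open set with null boundary is squeezed by continuous
functions. -/
theorem exists_squeeze_indC {U : Set Circ} (hU : IsOpen U) (hfr : volume (frontier U) = 0) :
    ∃ h K : ℕ → C(Circ, ℂ), (∀ m y, ‖h m y‖ ≤ 1) ∧ (∀ m y, ‖indC U y - h m y‖ ≤ (K m y).re) ∧
      Tendsto (fun m => ∫ y, K m y ∂haar) atTop (𝓝 0) ∧
      ∀ᵐ y ∂haar, Tendsto (fun m => h m y) atTop (𝓝 (indC U y)) := by
  have hδ : ∀ m : ℕ, (0 : ℝ) < 1 / ((m : ℝ) + 1) := fun m => by positivity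
  have hδ0 : Tendsto (fun m : ℕ => (1 : ℝ) / ((m : ℝ) + 1)) atTop (𝓝 0) :=
    tendsto_one_div_add_atTop_nhds_zero_nat
  set u : ℕ → Circ → ℝ := fun m y => (thickenedIndicator (hδ m) U y : ℝ) with hu
  -- Since `Uᶜ` is closed, `l m` increases to the indicator of `U` itself, while `u m` tends to that
  -- of the closure; the gap tends to the indicator of the null frontier.
  set l : ℕ → Circ → ℝ := fun m y => 1 - (thickenedIndicator (hδ m) Uᶜ y : ℝ) with hl
  have huc : ∀ m, Continuous (u m) := fun m =>
    NNReal.continuous_coe.comp (thickenedIndicator (hδ m) U).continuous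
  have hlc : ∀ m, Continuous (l m) := fun m =>
    continuous_const.sub (NNReal.continuous_coe.comp (thickenedIndicator (hδ m) Uᶜ).continuous)
  have hu1 : ∀ m y, u m y ≤ 1 := fun m y =>
    NNReal.coe_le_one.2 (thickenedIndicator_le_one (hδ m) U y)
  have hu0 : ∀ m y, 0 ≤ u m y := fun m y => NNReal.coe_nonneg _
  have hl1 : ∀ m y, l m y ≤ 1 := fun m y => by simp [hl]
  have hl0 : ∀ m y, 0 ≤ l m y := fun m y => by
    have : (thickenedIndicator (hδ m) Uᶜ y : ℝ) ≤ 1 := by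
      exact_mod_cast thickenedIndicator_le_one (hδ m) Uᶜ y
    simp only [hl]
    linarith
  have huU : ∀ m, ∀ y ∈ U, u m y = 1 := fun m y hy => by
    simp only [hu, thickenedIndicator_one (hδ m) U hy, NNReal.coe_one]
  have hlU : ∀ m, ∀ y ∉ U, l m y = 0 := fun m y hy => by
    simp only [hl, thickenedIndicator_one (hδ m) Uᶜ hy, NNReal.coe_one, sub_self]
  have hulim : ∀ y, Tendsto (fun m => u m y) atTop
      (𝓝 (((closure U).indicator (fun _ => (1 : ℝ≥0)) y : ℝ≥0) : ℝ)) := by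
    intro y
    exact (NNReal.continuous_coe.tendsto _).comp
      ((tendsto_pi_nhds.1 (thickenedIndicator_tendsto_indicator_closure hδ hδ0 U)) y)
  have hllim : ∀ y, Tendsto (fun m => l m y) atTop
      (𝓝 (1 - ((Uᶜ.indicator (fun _ => (1 : ℝ≥0)) y : ℝ≥0) : ℝ))) := by
    intro y
    have h1 := (tendsto_pi_nhds.1 (thickenedIndicator_tendsto_indicator_closure hδ hδ0 Uᶜ)) y
    rw [hU.isClosed_compl.closure_eq] at h1
    exact ((NNReal.continuous_coe.tendsto _).comp h1).const_sub 1
  refine ⟨fun m => ⟨fun y => (l m y : ℂ), Complex.continuous_ofReal.comp (hlc m)⟩,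
    fun m => ⟨fun y => ((u m y - l m y : ℝ) : ℂ),
      Complex.continuous_ofReal.comp ((huc m).sub (hlc m))⟩, ?_, ?_, ?_, ?_⟩
  · intro m y
    simp only [ContinuousMap.coe_mk, Complex.norm_real, Real.norm_of_nonneg (hl0 m y)]
    exact hl1 m y
  · intro m y
    simp only [ContinuousMap.coe_mk, Complex.ofReal_re, indC]
    by_cases hy : y ∈ U
    · rw [Set.indicator_of_mem hy, huU m y hy, ← Complex.ofReal_one, ← Complex.ofReal_sub,
        Complex.norm_real, Real.norm_of_nonneg (sub_nonneg.2 (hl1 m y))]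
    · rw [Set.indicator_of_notMem hy, hlU m y hy]
      simpa using hu0 m y
  · simp only [ContinuousMap.coe_mk, integral_complex_ofReal]
    rw [← Complex.ofReal_zero]
    refine (Complex.continuous_ofReal.tendsto _).comp ?_
    have h1 := tendsto_integral_of_dominated_convergence (μ := haar)
      (F := fun m y => u m y - l m y) (f := fun _ => (0 : ℝ)) (fun _ => (1 : ℝ)) ?_
      (integrable_const _) ?_ ?_
    · simpa using h1
    · exact fun m => ((huc m).sub (hlc m)).aestronglyMeasurable
    · refine fun m => Eventually.of_forall fun y => ?_
      rw [Real.norm_eq_abs, abs_le]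
      constructor <;> linarith [hu0 m y, hu1 m y, hl0 m y, hl1 m y]
    · have h2 : haar (frontier U) = 0 := haar_absolutelyContinuous hfr
      filter_upwards [measure_eq_zero_iff_ae_notMem.1 h2] with y hy
      have h3 := (hulim y).sub (hllim y)
      convert! h3 using 2
      by_cases hyU : y ∈ U
      · simp [hyU, subset_closure hyU]
      · have : y ∉ closure U := fun h => hy ⟨h, by rwa [hU.interior_eq]⟩
        simp [hyU, this]
  · refine Eventually.of_forall fun y => ?_
    have h1 : indC U y = ((1 - ((Uᶜ.indicator (fun _ => (1 : ℝ≥0)) y : ℝ≥0) : ℝ) : ℝ) : ℂ) := by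
      by_cases hyU : y ∈ U <;> simp [indC, hyU]
    rw [h1]
    exact (Complex.continuous_ofReal.tendsto _).comp (hllim y)

end Indicator


/-! ### Martingale differences of a random walk on the circle. -/

section RandomWalk

theorem norm_fourier_apply (k : ℤ) (y : Circ) : ‖fourier k y‖ = 1 := by
  rw [fourier_apply, Circle.norm_coe]

theorem fourier_apply_add (k : ℤ) (y z : Circ) :
    fourier k (y + z) = fourier k y * fourier k z := by
  simp only [fourier_apply, zsmul_add, AddCircle.toCircle_add, Circle.coe_mul]

theorem fourier_add_mul (k l : ℤ) (y : Circ) :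
    fourier (k + l) y = fourier k y * fourier l y := fourier_add

/-- Products of characters turn a translation of the whole path into a factor independent of time,
so the starting point plays no role in the averages. -/
theorem exists_wordEval_fourier_add (w : List (Option ℤ)) :
    ∃ K : ℤ, ∀ (c : Circ) (y : ℕ → Circ) (n : ℕ),
      wordEval (fun k => fourier k) (fun i => c + y i) w n
        = fourier K c * wordEval (fun k => fourier k) y w n := by
  induction w with
  | nil => exact ⟨0, fun c y n => by simp [wordEval]⟩
  | cons a w ih =>
    obtain ⟨K, hK⟩ := ih
    cases a with
    | none => exact ⟨K, fun c y n => hK c y (n + 1)⟩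
    | some l =>
      refine ⟨l + K, fun c y n => ?_⟩
      simp only [wordEval, hK, fourier_apply_add, fourier_add_mul]
      ring

theorem measurable_wordEval_fourier {Ω : Type*} {m : MeasurableSpace Ω} {y : ℕ → Ω → Circ} {N : ℕ}
    (hy : ∀ i ≤ N, Measurable (y i)) (w : List (Option ℤ)) (n : ℕ) (hn : n + steps w ≤ N) :
    Measurable fun ω => wordEval (fun k => fourier k) (fun i => y i ω) w n := by
  induction w generalizing n with
  | nil => exact measurable_const
  | cons a w ih =>
    cases a with
    | none =>
      simp only [steps] at hn
      exact ih (n + 1) (by omega)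
    | some l =>
      simp only [steps] at hn
      exact ((fourier l).continuous.measurable.comp (hy n (by omega))).mul (ih n hn)

/-- The information contained in the first `n` variables of a sequence. -/
noncomputable abbrev pastSigma {Ω : Type*} (ξ : ℕ → Ω → Circ) (n : ℕ) : MeasurableSpace Ω :=
  ⨆ i ∈ Set.Iio n, MeasurableSpace.comap (ξ i) inferInstance

theorem measurable_pastSigma {Ω : Type*} {ξ : ℕ → Ω → Circ} {i n : ℕ} (hin : i < n) :
    Measurable[pastSigma ξ n] (ξ i) :=
  Measurable.of_comap_le (le_iSup₂_of_le i hin le_rfl)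

variable {Ω : Type*} [mΩ : MeasurableSpace Ω] {P : Measure Ω}

theorem pastSigma_le {ξ : ℕ → Ω → Circ} (hξ : ∀ i, Measurable (ξ i)) (n : ℕ) :
    pastSigma ξ n ≤ mΩ :=
  iSup₂_le fun i _ => (hξ i).comap_le

/-- A variable independent of the past has zero correlation with it, if it is centred. -/
theorem integral_mul_eq_zero_of_past {ξ : ℕ → Ω → Circ} (hξ : ∀ i, Measurable (ξ i))
    (hindep : iIndepFun ξ P) {n : ℕ} {A : Ω → ℂ} (hA : Measurable[pastSigma ξ n] A) {g : Circ → ℂ}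
    (hg : Measurable g) (hg0 : ∫ ω, g (ξ n ω) ∂P = 0) : ∫ ω, A ω * g (ξ n ω) ∂P = 0 := by
  have h1 : Indep (pastSigma ξ n) (⨆ i ∈ ({n} : Set ℕ), MeasurableSpace.comap (ξ i) inferInstance)
      P :=
    indep_iSup_of_disjoint (fun i => (hξ i).comap_le) hindep.iIndep (by simp)
  have h2 : IndepFun A (fun ω => g (ξ n ω)) P := by
    rw [IndepFun_iff_Indep]
    refine indep_of_indep_of_le_left (indep_of_indep_of_le_right h1 ?_) hA.comap_le
    simp only [Set.mem_singleton_iff, iSup_iSup_eq_left]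
    exact (hg.comp (comap_measurable (ξ n))).comap_le
  rw [h2.integral_fun_mul_eq_mul_integral (hA.mono (pastSigma_le hξ n) le_rfl).aestronglyMeasurable
    (hg.comp (hξ n)).aestronglyMeasurable, hg0, mul_zero]

/-- Along a random walk with independent increments, the martingale differences built from
characters average out, whatever the starting point. -/
theorem ae_hasCesaro_fourier [IsProbabilityMeasure P] {x : ℕ → Ω → Circ} (hx : ∀ n, Measurable (x n))
    (hindep : iIndepFun (fun i ω => x (i + 1) ω - x i ω) P) {φ : ℤ → ℂ}
    (hφ : ∀ i k, ∫ ω, fourier k (x (i + 1) ω - x i ω) ∂P = φ k) :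
    ∀ᵐ ω ∂P, ∀ (w : List (Option ℤ)) (k : ℤ), HasCesaro (fun n =>
      wordEval (fun k => fourier k) (fun i => x i ω) w n *
        (fourier k (x (n + steps w + 1) ω) - φ k * fourier k (x (n + steps w) ω))) 0 := by
  rw [ae_all_iff]
  intro w
  rw [ae_all_iff]
  intro k
  set ξ : ℕ → Ω → Circ := fun i ω => x (i + 1) ω - x i ω with hξdef
  have hξ : ∀ i, Measurable (ξ i) := fun i => (hx (i + 1)).sub (hx i)
  -- The start `x 0` need not be independent of the increments; the path relative to it is a
  -- function of the increments alone.
  set y : ℕ → Ω → Circ := fun n ω => x n ω - x 0 ω with hydef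
  have hy : ∀ N, ∀ i ≤ N, Measurable[pastSigma ξ N] (y i) := by
    intro N i hi
    induction i with
    | zero =>
      have : y 0 = fun _ => 0 := by funext ω; simp [hydef]
      rw [this]
      exact measurable_const
    | succ i ih =>
      have : y (i + 1) = fun ω => y i ω + ξ i ω := by
        funext ω; simp [hydef, hξdef]
      rw [this]
      exact (ih (by omega)).add (measurable_pastSigma (by omega))
  set s := steps w with hs
  set G : ℕ → Ω → ℂ := fun n ω =>
    wordEval (fun k => fourier k) (fun i => y i ω) w n * fourier k (y (n + s) ω) with hG
  have hGm : ∀ n N, n + s ≤ N → Measurable[pastSigma ξ N] (G n) := fun n N hn =>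
    (measurable_wordEval_fourier (hy N) w n hn).mul
      ((fourier k).continuous.measurable.comp (hy N (n + s) hn))
  have hG1 : ∀ n ω, ‖G n ω‖ ≤ 1 := by
    intro n ω
    rw [hG, norm_mul, norm_fourier_apply, mul_one]
    exact norm_wordEval_le_one (fun c y => (norm_fourier_apply c y).le) w n
  set g : Circ → ℂ := fun z => fourier k z - φ k with hg
  have hgm : Measurable g := (fourier k).continuous.measurable.sub_const _
  have hφ1 : ‖φ k‖ ≤ 1 := by
    rw [← hφ 0 k]
    have := norm_integral_le_of_norm_le_const (μ := P)
      (f := fun ω => fourier k (x (0 + 1) ω - x 0 ω)) (C := 1)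
      (Eventually.of_forall fun ω => (norm_fourier_apply _ _).le)
    simpa using this
  have hg2 : ∀ z, ‖g z‖ ≤ 2 := fun z =>
    (norm_sub_le _ _).trans (by rw [norm_fourier_apply]; linarith)
  have hint : ∀ n, Integrable (fun ω => fourier k (ξ n ω)) P := fun n =>
    Integrable.of_bound ((fourier k).continuous.measurable.comp (hξ n)).aestronglyMeasurable 1
      (Eventually.of_forall fun ω => (norm_fourier_apply _ _).le)
  have hg0 : ∀ n, ∫ ω, g (ξ n ω) ∂P = 0 := by
    intro n
    rw [hg, integral_sub (hint n) (integrable_const _), integral_const, hφ n k]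
    simp
  have hLLN := hasCesaro_zero_of_orthogonal (P := P) (D := fun n ω => G n ω * g (ξ (n + s) ω))
    (C := 2) ?_ ?_ ?_
  · filter_upwards [hLLN] with ω hω
    obtain ⟨K, hK⟩ := exists_wordEval_fourier_add w
    have h1 := hω.const_mul (fourier (K + k) (x 0 ω))
    rw [mul_zero] at h1
    refine h1.congr (fun n => ?_)
    have h2 : ∀ i, x i ω = x 0 ω + y i ω := fun i => by simp [hydef]
    have h3 : x (n + s + 1) ω = x 0 ω + y (n + s) ω + ξ (n + s) ω := by simp [hydef, hξdef]
    have h4 : wordEval (fun k => fourier k) (fun i => x i ω) w n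
        = fourier K (x 0 ω) * wordEval (fun k => fourier k) (fun i => y i ω) w n := by
      rw [← hK]
      congr 1
      funext i
      exact h2 i
    rw [h4, h3, h2 (n + s)]
    simp only [hG, hg, fourier_apply_add, fourier_add_mul]
    ring
  · exact fun n => ((hGm n _ le_rfl).mono (pastSigma_le hξ _) le_rfl).mul (hgm.comp (hξ _))
  · intro n ω
    rw [norm_mul]
    calc ‖G n ω‖ * ‖g (ξ (n + s) ω)‖ ≤ 1 * 2 :=
          mul_le_mul (hG1 n ω) (hg2 _) (norm_nonneg _) zero_le_one
      _ = 2 := one_mul 2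
  · intro m n hmn
    have hconj : Measurable fun z : ℂ => conj z := Complex.continuous_conj.measurable
    -- For `m < n` everything but the last increment `ξ (n + s)` belongs to its past, and that
    -- increment enters through a centred factor.
    have hA : Measurable[pastSigma ξ (n + s)]
        fun ω => G m ω * g (ξ (m + s) ω) * conj (G n ω) :=
      ((hGm m _ (by omega)).mul (hgm.comp (measurable_pastSigma (by omega)))).mul
        (hconj.comp (hGm n _ le_rfl))
    have h0 : ∫ ω, conj (g (ξ (n + s) ω)) ∂P = 0 := by
      rw [integral_conj, hg0, map_zero]
    have h1 := integral_mul_eq_zero_of_past hξ hindep hA (hconj.comp hgm) h0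
    rw [← h1]
    refine integral_congr_ae (Eventually.of_forall fun ω => ?_)
    simp only [map_mul, Function.comp_apply]
    ring

end RandomWalk


/-! ### Fourier coefficients of densities. -/

section FourierCoefficients

theorem fourierHat_eq_smul_fourierCoeff (g : Circ → ℝ) (k : ℤ) :
    fourierHat g k = (2 * π : ℝ) • fourierCoeff (fun y => (g y : ℂ)) k := by
  have h : (2 * π : ℝ) ≠ 0 := Real.two_pi_pos.ne'
  rw [fourierCoeff, AddCircle.integral_haarAddCircle, smul_inv_smul₀ h, fourierHat]
  simp only [smul_eq_mul, mul_comm]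

theorem memLp_haar_of_volume {g : Circ → ℝ} (hg : MemLp g 2 volume) :
    MemLp (fun y => (g y : ℂ)) 2 haar := by
  exact memLp_haarAddCircle_iff.2 hg.ofReal

/-- The Riemann–Lebesgue lemma for square-integrable functions. -/
theorem tendsto_fourierCoeff_cofinite {f : Circ → ℂ} (hf : MemLp f 2 haar) :
    Tendsto (fourierCoeff f) cofinite (𝓝 0) := by
  have h1 := (hasSum_sq_fourierCoeff (hf.toLp f)).summable.tendsto_cofinite_zero
  have h2 := h1.sqrt
  simp only [Real.sqrt_zero, Real.sqrt_sq (norm_nonneg _)] at h2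
  rw [tendsto_zero_iff_norm_tendsto_zero]
  refine h2.congr (fun k => ?_)
  rw [fourierCoeff_congr_ae hf.coeFn_toLp]

theorem fourierCoeff_conj_of_real (g : Circ → ℝ) (k : ℤ) :
    fourierCoeff (fun y => (g y : ℂ)) (-k) = conj (fourierCoeff (fun y => (g y : ℂ)) k) := by
  simp only [fourierCoeff]
  rw [← integral_conj]
  congr 1
  funext y
  simp only [smul_eq_mul, map_mul, Complex.conj_ofReal, ← fourier_neg]

theorem fourierHat_neg_of_symm {g : Circ → ℝ} (hg : ∀ᵐ y : Circ, g y = g (-y)) (k : ℤ) :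
    fourierHat g (-k) = fourierHat g k := by
  unfold fourierHat
  rw [← integral_neg_eq_self]
  refine integral_congr_ae ?_
  filter_upwards [hg] with y hy
  rw [← hy]
  congr 1
  simp [fourier_apply]

end FourierCoefficients

/-! ### Eigenvalues of the transition operator. -/

section Law

variable {Ω : Type*} [MeasurableSpace Ω] {P : Measure Ω} {X : ℝ≥0 → Ω → Circ}
  {D : ℝ≥0 → Measure Circ} {β : ℝ≥0 → ℝ} {γ : ℝ≥0 → Circ → ℝ}

theorem IsIncrementProcess.isProbabilityMeasure [IsProbabilityMeasure P]
    (hX : IsIncrementProcess P X D) (t : ℝ≥0) : IsProbabilityMeasure (D t) := by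
  have h := hX.hasLaw_sub 0 t zero_le
  rw [tsub_zero] at h
  rw [← h.map_eq]
  exact Measure.isProbabilityMeasure_map h.aemeasurable

/-- The eigenvalues of the transition operator of the process over a time `t`. -/
noncomputable def charLaw (D : ℝ≥0 → Measure Circ) (t : ℝ≥0) (k : ℤ) : ℂ :=
  ∫ y, fourier k y ∂(D t)

theorem integrable_fourier (ν : Measure Circ) [IsFiniteMeasure ν] (k : ℤ) :
    Integrable (fun y => fourier k y) ν :=
  Integrable.of_bound (fourier k).continuous.aestronglyMeasurable 1
    (Eventually.of_forall fun y => (norm_fourier_apply k y).le)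

theorem norm_charLaw_le [IsProbabilityMeasure P] (hX : IsIncrementProcess P X D) (t : ℝ≥0)
    (k : ℤ) : ‖charLaw D t k‖ ≤ 1 := by
  have := hX.isProbabilityMeasure t
  have h := norm_integral_le_of_norm_le_const (μ := D t) (f := fun y => fourier k y) (C := 1)
    (Eventually.of_forall fun y => (norm_fourier_apply k y).le)
  simpa [charLaw] using h

theorem charLaw_zero_right [IsProbabilityMeasure P] (hX : IsIncrementProcess P X D) (t : ℝ≥0) :
    charLaw D t 0 = 1 := by
  have := hX.isProbabilityMeasure t
  simp [charLaw]

theorem charLaw_neg (t : ℝ≥0) (k : ℤ) : charLaw D t (-k) = conj (charLaw D t k) := by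
  unfold charLaw
  rw [← integral_conj]
  simp only [fourier_neg]

theorem charLaw_add [IsProbabilityMeasure P] (hX : IsIncrementProcess P X D) (s t : ℝ≥0) (k : ℤ) :
    charLaw D (s + t) k = charLaw D s k * charLaw D t k := by
  have := hX.isProbabilityMeasure
  unfold charLaw
  rw [hX.conv_eq, integral_conv]
  · simp only [fourier_apply_add, integral_const_mul, integral_mul_const]
  · rw [← hX.conv_eq]
    exact integrable_fourier _ k

theorem charLaw_nsmul [IsProbabilityMeasure P] (hX : IsIncrementProcess P X D) (t : ℝ≥0) (k : ℤ)
    (n : ℕ) : charLaw D ((n + 1) • t) k = charLaw D t k ^ (n + 1) := by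
  induction n with
  | zero => simp
  | succ n ih => rw [succ_nsmul, charLaw_add hX, ih, ← pow_succ]

theorem charLaw_eq (hD : IsAtomDensityMixture D β γ) {t : ℝ≥0} (ht : 0 < t) (k : ℤ) :
    charLaw D t k = β t + (1 - β t) * fourierHat (γ t) (-k) := by
  have hβ := hD.mem_Icc t ht
  have hγ := hD.density t ht
  have hγm : AEMeasurable (γ t) volume := hγ.memLp.aestronglyMeasurable.aemeasurable
  have hγi : Integrable (γ t) volume := hγ.memLp.integrable one_le_two
  have hfin : IsFiniteMeasure ((volume : Measure Circ).withDensity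
      fun x => ENNReal.ofReal (γ t x)) :=
    isFiniteMeasure_withDensity_ofReal hγi.2
  unfold charLaw
  rw [hD.eq_mixture t ht, integral_add_measure, integral_smul_measure, integral_smul_measure,
    integral_dirac, fourier_eval_zero, ENNReal.toReal_ofReal hβ.1,
    ENNReal.toReal_ofReal (sub_nonneg.2 hβ.2),
    integral_withDensity_eq_integral_toReal_smul₀ hγm.ennreal_ofReal
      (Eventually.of_forall fun y => ENNReal.ofReal_lt_top)]
  · have h : ∫ y, (ENNReal.ofReal (γ t y)).toReal • fourier k y = fourierHat (γ t) (-k) := by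
      unfold fourierHat
      refine integral_congr_ae ?_
      filter_upwards [hγ.nonneg] with y hy
      rw [ENNReal.toReal_ofReal hy, neg_neg, Complex.real_smul]
    rw [h]
    simp
  · exact (integrable_fourier _ k).smul_measure ENNReal.ofReal_ne_top
  · exact (integrable_fourier _ k).smul_measure ENNReal.ofReal_ne_top

theorem tendsto_charLaw (hD : IsAtomDensityMixture D β γ) {t : ℝ≥0} (ht : 0 < t) :
    Tendsto (charLaw D t) cofinite (𝓝 (β t : ℂ)) := by
  have h1 := tendsto_fourierCoeff_cofinite (memLp_haar_of_volume (hD.density t ht).memLp)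
  have h2 : Tendsto (fun k : ℤ => fourierHat (γ t) (-k)) cofinite (𝓝 0) := by
    have h3 := (h1.comp neg_injective.tendsto_cofinite).const_smul (2 * π : ℝ)
    rw [smul_zero] at h3
    refine h3.congr (fun k => ?_)
    rw [fourierHat_eq_smul_fourierCoeff]
    rfl
  have h3 := (h2.const_mul (1 - β t : ℂ)).const_add (β t : ℂ)
  rw [mul_zero, add_zero] at h3
  exact h3.congr (fun k => (charLaw_eq hD ht k).symm)

/-- The process moves with positive probability over each positive time. -/
theorem atom_ne_one [IsProbabilityMeasure P] (hX : IsIncrementProcess P X D)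
    (hD : IsAtomDensityMixture D β γ) {t₀ : ℝ≥0} (ht₀ : 0 < t₀) : β t₀ ≠ 1 := by
  intro h1
  obtain ⟨t, ht, hβt⟩ := hD.exists_ne_one
  apply hβt
  obtain ⟨n, hn⟩ := exists_nat_ge (t / t₀)
  -- A fraction of `t` that is at most `t₀`. If all characters had mean one at time `t₀`, they would
  -- have means of modulus one at time `r`, hence at `t`; but these means tend to `β t`, which would
  -- then be `1`.
  set r : ℝ≥0 := t / (n + 1 : ℕ) with hr
  have hrt : (n + 1) • r = t := by
    rw [hr, nsmul_eq_mul, mul_div_cancel₀]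
    exact_mod_cast n.succ_ne_zero
  have hrle : r ≤ t₀ := by
    rw [hr, div_le_iff₀ (by exact_mod_cast n.succ_pos)]
    rw [div_le_iff₀ ht₀] at hn
    push_cast
    calc t ≤ n * t₀ := hn
      _ ≤ t₀ * (n + 1) := by rw [mul_comm]; gcongr; exact le_self_add
  have hone : ∀ k, ‖charLaw D t k‖ = 1 := by
    intro k
    have h2 : charLaw D t₀ k = 1 := by
      rw [charLaw_eq hD ht₀, h1]
      simp
    rw [← add_tsub_cancel_of_le hrle, charLaw_add hX] at h2
    have h3 := congrArg norm h2
    rw [norm_mul, norm_one] at h3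
    have h4 : ‖charLaw D r k‖ = 1 := by
      refine le_antisymm (norm_charLaw_le hX r k) ?_
      rw [← h3]
      exact mul_le_of_le_one_right (norm_nonneg _) (norm_charLaw_le hX _ k)
    rw [← hrt, charLaw_nsmul hX, norm_pow, h4, one_pow]
  have h5 := (tendsto_charLaw hD ht).norm
  simp only [hone] at h5
  have h6 := tendsto_nhds_unique h5 tendsto_const_nhds
  rw [Complex.norm_real, Real.norm_of_nonneg (hD.mem_Icc t ht).1] at h6
  exact h6

theorem charLaw_neg_of_symm (hD : IsAtomDensityMixture D β γ) {t : ℝ≥0} (ht : 0 < t)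
    (hsymm : ∀ᵐ y : Circ, γ t y = γ t (-y)) (k : ℤ) : charLaw D t (-k) = charLaw D t k := by
  rw [charLaw_eq hD ht, charLaw_eq hD ht, fourierHat_neg_of_symm hsymm (-k)]

theorem charLaw_eq_re (hD : IsAtomDensityMixture D β γ) {t : ℝ≥0} (ht : 0 < t)
    (hsymm : ∀ᵐ y : Circ, γ t y = γ t (-y)) (k : ℤ) : charLaw D t k = (charLaw D t k).re := by
  refine (Complex.conj_eq_iff_re.1 ?_).symm
  rw [← charLaw_neg, charLaw_neg_of_symm hD ht hsymm]

/-- The eigenvalues of the transition operator separate frequencies up to sign. -/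
theorem eq_or_eq_neg_of_charLaw_eq [IsProbabilityMeasure P] (hX : IsIncrementProcess P X D)
    (hD : IsAtomDensityMixture D β γ) {t : ℝ≥0} (ht : 0 < t)
    (hsymm : ∀ᵐ y : Circ, γ t y = γ t (-y))
    (hinj : Function.Injective (fun k : ℕ => fourierHat (γ t) (k : ℤ))) {j k : ℤ}
    (h : charLaw D t j = charLaw D t k) : j = k ∨ j = -k := by
  have h1 : ∀ k : ℤ, charLaw D t k = β t + (1 - β t) * fourierHat (γ t) (k.natAbs : ℤ) := by
    intro k
    rcases Int.natAbs_eq k with hk | hk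
    · rw [← charLaw_neg_of_symm hD ht hsymm k, charLaw_eq hD ht, neg_neg, ← hk]
    · rw [charLaw_eq hD ht]
      conv_lhs => rw [hk, neg_neg]
  have h2 : (1 - β t : ℂ) ≠ 0 := by
    rw [sub_ne_zero]
    exact_mod_cast (atom_ne_one hX hD ht).symm
  rw [h1, h1] at h
  exact Int.natAbs_eq_natAbs_iff.1 (hinj (mul_left_cancel₀ h2 (add_left_cancel h)))

end Law

/-! ### Ergodicity of the sampled process. -/

section ErgodicPaths

variable {Ω : Type*} [MeasurableSpace Ω] {P : Measure Ω} [IsProbabilityMeasure P]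
  {X : ℝ≥0 → Ω → Circ} {D : ℝ≥0 → Measure Circ}

/-- Almost every path of the process, sampled at the multiples of a fixed time, is ergodic. -/
theorem IsIncrementProcess.ae_isErgodicSeq (hX : IsIncrementProcess P X D) (t : ℝ≥0)
    (hne : ∀ k, k ≠ 0 → charLaw D t k ≠ 1) {T : L2Circ →L[ℂ] L2Circ}
    (hT : ∀ k, T (fourierBasis k) = charLaw D t k • fourierBasis k) :
    ∀ᵐ ω ∂P, IsErgodicSeq T (fun n : ℕ => X (n * t) ω) := by
  have hmono : Monotone fun n : ℕ => (n : ℝ≥0) * t := fun m n hmn => by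
    dsimp only
    gcongr
  have hindep := hX.hasIndepIncrements.nat hmono
  have hφ : ∀ (i : ℕ) (k : ℤ), ∫ ω, fourier k (X ((i + 1 : ℕ) * t) ω - X (i * t) ω) ∂P
      = charLaw D t k := by
    intro i k
    have hlaw := hX.hasLaw_sub (i * t) ((i + 1 : ℕ) * t) (hmono (Nat.le_succ i))
    have hsub : ((i + 1 : ℕ) : ℝ≥0) * t - i * t = t := by
      push_cast
      rw [add_mul, one_mul, add_tsub_cancel_left]
    rw [hsub] at hlaw
    unfold charLaw
    rw [← hlaw.map_eq, integral_map hlaw.aemeasurable (fourier k).continuous.aestronglyMeasurable]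
  filter_upwards [ae_hasCesaro_fourier (fun n : ℕ => hX.measurable (n * t)) hindep hφ] with ω hω
  exact isErgodicSeq_of_fourier hT hne hω

end ErgodicPaths


/-! ### Path coefficients determine an indicator up to isometry. -/

section Uniqueness

theorem ae_eq_of_fourierCoeff_eq {u v : Circ → ℂ} (hu : MemLp u 2 haar) (hv : MemLp v 2 haar)
    (h : ∀ k, fourierCoeff u k = fourierCoeff v k) : u =ᵐ[haar] v := by
  have h1 : hu.toLp u = hv.toLp v := by
    apply (fourierBasis (T := 2 * π)).repr.injective
    ext k
    rw [fourierBasis_repr, fourierBasis_repr, fourierCoeff_congr_ae hu.coeFn_toLp,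
      fourierCoeff_congr_ae hv.coeFn_toLp, h]
  exact (MemLp.toLp_eq_toLp_iff hu hv).1 h1

theorem fourierCoeff_comp_add (u : Circ → ℂ) (c : Circ) (k : ℤ) :
    fourierCoeff (fun y => u (y + c)) k = fourier k c * fourierCoeff u k := by
  unfold fourierCoeff
  rw [← integral_add_right_eq_self (fun y => fourier (-k) y • u y) c, ← integral_const_mul]
  congr 1
  funext y
  have h1 : fourier k c * fourier (-k) c = 1 := by
    rw [← fourier_add_mul, add_neg_cancel]
    simp
  simp only [smul_eq_mul, fourier_apply_add]
  linear_combination -(fourier (-k) y * u (y + c)) * h1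

theorem fourierCoeff_comp_neg (u : Circ → ℂ) (k : ℤ) :
    fourierCoeff (fun y => u (-y)) k = fourierCoeff u (-k) := by
  unfold fourierCoeff
  rw [← integral_neg_eq_self]
  congr 1
  funext y
  simp [fourier_apply]

theorem exp_eq_fourier (k : ℤ) (θ : ℝ) :
    Complex.exp (Complex.I * k * θ) = fourier k (θ : Circ) := by
  have h := fourier_neg_coe (-k) θ
  rw [neg_neg] at h
  rw [h]
  congr 1
  push_cast
  ring

variable {U V : Set Circ}

theorem memLp_two_indC (hU : IsOpen U) : MemLp (indC U) 2 haar :=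
  (memLp_indC hU).mono_exponent le_top

theorem indC_eq_ofReal (U : Set Circ) :
    indC U = fun y => ((U.indicator (fun _ => (1 : ℝ)) y : ℝ) : ℂ) := by
  funext y
  by_cases hy : y ∈ U <;> simp [indC, hy]

/-- An indicator function whose Fourier series is finite is almost everywhere constant. -/
theorem fourierCoeff_indC_eq_zero_of_finite (hU : IsOpen U)
    (hfin : {k | fourierCoeff (indC U) k ≠ 0}.Finite) {k : ℤ} (hk : k ≠ 0) :
    fourierCoeff (indC U) k = 0 := by
  set a := fourierCoeff (indC U) with ha
  set p : C(Circ, ℂ) := ∑ k ∈ hfin.toFinset, a k • fourier k with hp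
  have hae : indC U =ᵐ[haar] p := by
    have h0 : ∀ k, fourierCoeff ((memLp_two_indC hU).toLp (indC U)) k = a k := fun k => by
      rw [fourierCoeff_congr_ae (memLp_two_indC hU).coeFn_toLp]
    have h1 := hasSum_fourier_series_L2 ((memLp_two_indC hU).toLp (indC U))
    simp only [h0] at h1
    have h2 := hasSum_sum_of_ne_finset_zero (s := hfin.toFinset)
      (L := SummationFilter.unconditional ℤ) (f := fun k => a k • (fourierLp 2 k : L2Circ)) (fun k hk => by
        have : a k = 0 := by simpa using hk
        simp [this])
    have h3 := h1.unique h2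
    have h4 : ∑ k ∈ hfin.toFinset, a k • (fourierLp 2 k : L2Circ)
        = ContinuousMap.toLp 2 haar ℂ p := by
      simp only [hp, map_sum, map_smul]
    rw [h4] at h3
    have h5 := (memLp_two_indC hU).coeFn_toLp
    rw [h3] at h5
    exact h5.symm.trans (ContinuousMap.coeFn_toLp haar p)
  -- The trigonometric polynomial is continuous and idempotent almost everywhere, hence everywhere;
  -- on the connected circle it is constant.
  have hsq : ∀ y, p y * p y = p y := by
    have h1 : (fun y => p y * p y) =ᵐ[haar] p := by
      filter_upwards [hae] with y hy
      rw [← hy]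
      by_cases hyU : y ∈ U <;> simp [indC, hyU]
    exact congrFun ((Continuous.ae_eq_iff_eq haar (p.continuous.mul p.continuous)
      p.continuous).1 h1)
  have h01 : ∀ y, p y = 0 ∨ p y = 1 := by
    intro y
    by_cases h : p y = 0
    · exact Or.inl h
    · exact Or.inr (mul_left_cancel₀ h (by rw [hsq, mul_one]))
  have hclopen : IsClopen {y | p y = 1} := by
    refine ⟨isClosed_eq p.continuous continuous_const, ?_⟩
    have : {y | p y = 1} = {y | p y = 0}ᶜ := by
      ext y
      rcases h01 y with h | h <;> simp [h]
    rw [this]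
    exact (isClosed_eq p.continuous continuous_const).isOpen_compl
  have hconst : ∃ c : ℂ, ∀ y, p y = c := by
    rcases isClopen_iff.1 hclopen with h | h
    · refine ⟨0, fun y => (h01 y).resolve_right fun hy => ?_⟩
      have : y ∈ {y | p y = 1} := hy
      rw [h] at this
      exact this
    · refine ⟨1, fun y => ?_⟩
      have : y ∈ {y | p y = 1} := by rw [h]; trivial
      exact this
  obtain ⟨c, hc⟩ := hconst
  rw [ha, fourierCoeff_congr_ae hae]
  have h1 : (p : Circ → ℂ) = fun y => c * fourier 0 y := by
    funext y
    simp [hc]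
  rw [h1, fourierCoeff.const_mul, fourierCoeff_fourier]
  simp [hk]

/-- Two indicator functions with the same path coefficients agree up to a rotation and a
reflection. -/
theorem exists_isometry_of_pathCoeff_eq (hU : IsOpen U) (hV : IsOpen V)
    (h : ∀ l : List ℤ, (∀ j ∈ l, 0 < j) →
      pathCoeff (fourierCoeff (indC V)) l 0 = pathCoeff (fourierCoeff (indC U)) l 0) :
    ∃ θ : Circ, (∀ᵐ y : Circ, indC V y = indC U (y + θ)) ∨
      ∀ᵐ y : Circ, indC V y = indC U (-y + θ) := by
  have hconj : ∀ U : Set Circ, ∀ k,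
      fourierCoeff (indC U) (-k) = conj (fourierCoeff (indC U) k) := fun U k => by
    rw [indC_eq_ofReal]
    exact fourierCoeff_conj_of_real _ k
  have hlimU := tendsto_fourierCoeff_cofinite (memLp_two_indC hU)
  have hlimV := tendsto_fourierCoeff_cofinite (memLp_two_indC hV)
  have key : ∃ θ : ℝ, (∀ k : ℤ, fourierCoeff (indC V) k
      = Complex.exp (Complex.I * k * θ) * fourierCoeff (indC U) k) ∨
      ∀ k : ℤ, fourierCoeff (indC V) k
        = Complex.exp (Complex.I * k * θ) * fourierCoeff (indC U) (-k) := by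
    -- The asymptotic argument needs arbitrarily large `J` with nonzero coefficient. Otherwise `U`
    -- has a constant indicator, and the paths `[k]` and `[]` show that `V` has the same
    -- coefficients.
    by_cases hinf : ∃ᶠ J : ℕ in atTop, fourierCoeff (indC U) J ≠ 0
    · exact exists_isometry_of_re_prod_eq (hconj U) (hconj V)
        (re_prod_eq_of_pathCoeff_eq (hconj U) (hconj V) hlimU hlimV hinf h)
    · have hfin : {k | fourierCoeff (indC U) k ≠ 0}.Finite := by
        simp only [not_frequently, not_not] at hinf
        obtain ⟨N, hN⟩ := eventually_atTop.1 hinf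
        refine (Set.finite_Icc (-(N : ℤ)) N).subset (fun k hk => ?_)
        by_contra hkN
        apply hk
        rcases Int.natAbs_eq k with h1 | h1
        · rw [h1]
          refine hN _ ?_
          rw [Set.mem_Icc] at hkN
          omega
        · rw [h1, hconj, hN _ ?_, map_zero]
          rw [Set.mem_Icc] at hkN
          omega
      have hU0 : ∀ k : ℤ, k ≠ 0 → fourierCoeff (indC U) k = 0 := fun k hk =>
        fourierCoeff_indC_eq_zero_of_finite hU hfin hk
      have hV0 : ∀ k : ℤ, 0 < k → fourierCoeff (indC V) k = 0 := by
        intro k hk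
        have h1 := h [k] (by simpa using hk)
        rw [pathCoeff_singleton_zero (hconj U), pathCoeff_singleton_zero (hconj V),
          hU0 k hk.ne'] at h1
        have h2 : (2 * ‖fourierCoeff (indC V) k‖ ^ 2 : ℝ) = 0 := by
          have := Complex.ofReal_inj.1 h1
          simpa using this
        simpa using h2
      refine ⟨0, Or.inl fun k => ?_⟩
      simp only [Complex.ofReal_zero, mul_zero, Complex.exp_zero, one_mul]
      rcases lt_trichotomy k 0 with hk | rfl | hk
      · rw [hU0 k hk.ne, ← neg_neg k, hconj, hV0 (-k) (by omega), map_zero]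
      · exact h [] (by simp)
      · rw [hU0 k hk.ne', hV0 k hk]
  have hshift : ∀ c : Circ, MemLp (fun y => indC U (y + c)) 2 haar := fun c =>
    (memLp_two_indC hU).comp_measurePreserving (measurePreserving_add_right haar c)
  obtain ⟨θ, hθ | hθ⟩ := key
  · refine ⟨(θ : Circ), Or.inl (volume_absolutelyContinuous.ae_le ?_)⟩
    refine ae_eq_of_fourierCoeff_eq (memLp_two_indC hV) (hshift θ) (fun k => ?_)
    rw [hθ, exp_eq_fourier, fourierCoeff_comp_add]
  -- The reflection turns frequency `k` into `-k`, so the translation must change sign as well.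
  · refine ⟨((-θ : ℝ) : Circ), Or.inr (volume_absolutelyContinuous.ae_le ?_)⟩
    refine ae_eq_of_fourierCoeff_eq (v := fun y => indC U (-y + ((-θ : ℝ) : Circ)))
      (memLp_two_indC hV)
      ((hshift ((-θ : ℝ) : Circ)).comp_measurePreserving (Measure.measurePreserving_neg haar))
      (fun k => ?_)
    rw [hθ, fourierCoeff_comp_neg (fun y => indC U (y + ((-θ : ℝ) : Circ))),
      fourierCoeff_comp_add, ← exp_eq_fourier]
    congr 2
    push_cast
    ring

end Uniqueness

/-! ### Matching traces with open sets, and the reconstruction. -/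

/-- The averages of the products of the trace along words, at the multiples of a time `t`, are
those of the stationary random walk with transition operator `T` observed through the indicator
function of `U`. -/
def TraceMatches (T : L2Circ →L[ℂ] L2Circ) (t : ℝ≥0) (τ : ℝ≥0 → ℝ) (U : Set Circ) : Prop :=
  ∃ hU : IsOpen U, ∀ w : List (Option Unit),
    HasCesaro (wordEval (fun _ (r : ℝ) => (r : ℂ)) (fun n : ℕ => τ (n * t)) w)
      (inner ℂ (fourierBasis 0 : L2Circ)
        (wordOp (fun _ => mulLp ((memLp_indC hU).toLp)) T w (fourierBasis 0)))

theorem wordEval_comp {α E E' : Type*} (F : α → E' → ℂ) (f : E → E') (x : ℕ → E)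
    (w : List (Option α)) (n : ℕ) :
    wordEval F (fun i => f (x i)) w n = wordEval (fun c y => F c (f y)) x w n := by
  induction w generalizing n with
  | nil => rfl
  | cons c w ih => cases c <;> simp [wordEval, ih]

/-- Averages along words match for the trace of an ergodic path. -/
theorem IsErgodicSeq.traceMatches {T : L2Circ →L[ℂ] L2Circ} {t : ℝ≥0} {p : ℝ≥0 → Circ}
    (hp : IsErgodicSeq T fun n : ℕ => p (n * t)) {U : Set Circ} (hU : IsOpen U)
    (hfr : volume (frontier U) = 0) :
    TraceMatches T t (fun s => U.indicator (fun _ => (1 : ℝ)) (p s)) U := by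
  refine ⟨hU, fun w => ?_⟩
  obtain ⟨h, K, h1, h2, h3, h4⟩ := exists_squeeze_indC hU hfr
  refine (hp.hasCesaro_wordEval (memLp_indC hU) (norm_indC_le U) h1 h2 h3 h4 w).congr (fun n => ?_)
  rw [wordEval_comp (fun _ (r : ℝ) => (r : ℂ)) (U.indicator fun _ => (1 : ℝ)), indC_eq_ofReal]

theorem exists_isometry_of_traceMatches {T : L2Circ →L[ℂ] L2Circ} {t : ℝ≥0} {τ : ℝ≥0 → ℝ}
    {φ : ℤ → ℝ} (hT : ∀ k, T (fourierBasis k) = (φ k : ℂ) • fourierBasis k)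
    (hφ : ∀ k, |φ k| ≤ 1) (heven : ∀ k, φ (-k) = φ k)
    (hinj : ∀ j k, φ j = φ k → j = k ∨ j = -k) {U V : Set Circ} (hU : TraceMatches T t τ U)
    (hV : TraceMatches T t τ V) :
    ∃ θ : Circ, (∀ᵐ y : Circ, indC V y = indC U (y + θ)) ∨
      ∀ᵐ y : Circ, indC V y = indC U (-y + θ) := by
  obtain ⟨hUo, hU⟩ := hU
  obtain ⟨hVo, hV⟩ := hV
  have hM : ∀ {U : Set Circ} (hU : IsOpen U) (j k : ℤ), inner ℂ (fourierBasis j : L2Circ)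
      (mulLp ((memLp_indC hU).toLp) (fourierBasis k)) = fourierCoeff (indC U) (j - k) := by
    intro U hU j k
    rw [inner_fourierBasis_mulLp, fourierCoeff_congr_ae (memLp_indC hU).coeFn_toLp]
  exact exists_isometry_of_pathCoeff_eq hUo hVo (pathCoeff_eq_of_wordOp fourierBasis hT hφ heven
    hinj (hM hVo) (hM hUo) (fun w => tendsto_nhds_unique (hV w) (hU w)))

end Scenery

theorem theorem1p3 {Ω : Type*} [MeasurableSpace Ω] (P : Measure Ω) [IsProbabilityMeasure P]
    (X : ℝ≥0 → Ω → Scenery.Circ) (D : ℝ≥0 → Measure Scenery.Circ)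
    (β : ℝ≥0 → ℝ) (γ : ℝ≥0 → Scenery.Circ → ℝ)
    (hX : Scenery.IsIncrementProcess P X D)
    (hD : Scenery.IsAtomDensityMixture D β γ)
    (hsymm : ∀ t, 0 < t → ∀ᵐ y : Scenery.Circ, γ t y = γ t (-y))
    (t₀ : ℝ≥0) (ht₀ : 0 < t₀)
    (hinj : Function.Injective (fun k : ℕ => Scenery.fourierHat (γ t₀) (k : ℤ)))
    (hne : ∀ k : ℕ, Scenery.fourierHat (γ t₀) (k : ℤ) ≠ 0) :
    Scenery.IsReconstructibleUpToReflections P X Scenery.openIndicators := by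
  classical
  set φ : ℤ → ℝ := fun k => (Scenery.charLaw D t₀ k).re with hφdef
  have hφ : ∀ k, Scenery.charLaw D t₀ k = φ k := Scenery.charLaw_eq_re hD ht₀ (hsymm t₀ ht₀)
  have hφinj : ∀ j k, φ j = φ k → j = k ∨ j = -k := fun j k h =>
    Scenery.eq_or_eq_neg_of_charLaw_eq hX hD ht₀ (hsymm t₀ ht₀) hinj (by rw [hφ, hφ, h])
  have hφle : ∀ k, |φ k| ≤ 1 := fun k =>
    (Complex.abs_re_le_norm _).trans (Scenery.norm_charLaw_le hX t₀ k)
  have hφeven : ∀ k, φ (-k) = φ k := fun k => by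
    simp only [hφdef, Scenery.charLaw_neg_of_symm hD ht₀ (hsymm t₀ ht₀)]
  have hφone : ∀ k, k ≠ 0 → Scenery.charLaw D t₀ k ≠ 1 := by
    intro k hk h
    rw [← Scenery.charLaw_zero_right hX t₀] at h
    rcases Scenery.eq_or_eq_neg_of_charLaw_eq hX hD ht₀ (hsymm t₀ ht₀) hinj h with h | h
    · exact hk h
    · exact hk (by simpa using h)
  obtain ⟨T, hT⟩ := Scenery.exists_diagonal (fourierBasis (T := 2 * π))
    (c := Scenery.charLaw D t₀) (Scenery.norm_charLaw_le hX t₀)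
  have hT' : ∀ k, T (fourierBasis k) = (φ k : ℂ) • fourierBasis k := fun k => by rw [hT, hφ]
  -- Any matching set will do, since two sets matching the same trace differ by an isometry up to a
  -- null set. The default `0` is used only off the almost sure event.
  refine ⟨fun τ => if h : ∃ U, Scenery.TraceMatches T t₀ τ U then
    h.choose.indicator (fun _ => 1) else 0, ?_⟩
  rintro f ⟨U, hU, hfr, rfl⟩
  filter_upwards [hX.ae_isErgodicSeq t₀ hφone hT] with ω hω
  have hmatch := hω.traceMatches (p := fun s => X s ω) hU hfr
  have hex : ∃ V, Scenery.TraceMatches T t₀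
      (fun s => U.indicator (fun _ => (1 : ℝ)) (X s ω)) V := ⟨U, hmatch⟩
  have hreal : ∀ (V : Set Scenery.Circ) (y z : Scenery.Circ),
      Scenery.indC V y = Scenery.indC U z →
      V.indicator (fun _ => (1 : ℝ)) y = U.indicator (fun _ => (1 : ℝ)) z := by
    intro V y z h
    rw [Scenery.indC_eq_ofReal, Scenery.indC_eq_ofReal] at h
    exact Complex.ofReal_injective h
  simp only [dif_pos hex]
  obtain ⟨θ, hθ⟩ := Scenery.exists_isometry_of_traceMatches hT' hφle hφeven hφinj hmatch
    hex.choose_spec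
  refine ⟨θ, hθ.imp (fun h => ?_) (fun h => ?_)⟩
  · filter_upwards [h] with y hy using hreal _ _ _ hy
  · filter_upwards [h] with y hy using hreal _ _ _ hy
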